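/- **Theorem 4.1 (Line Arrangement Isomorphism Theorem).** Let $\mathbb F$ be an ordered field and $n\ge 0$. A *line arrangement* of $n$ lines is a set of $n$ lines in $\mathbb F^2$ such that no two are parallel and no three are concurrent; its *intersection points* are the points of intersection of two distinct lines of the arrangement. Let $\mathcal A,\mathcal B$ be two line arrangements of $n$ lines, with sets of intersection points $\mathcal P_{\mathcal A},\mathcal P_{\mathcal B}$. Let $\phi:\mathcal P_{\mathcal A}\to\mathcal P_{\mathcal B}$ be a *line arrangement collineation isomorphism*, i.e. a bijection such that whenever three distinct points $P,Q,R\in\mathcal P_{\mathcal A}$ lie on a common line of $\mathcal A$, the points $\phi(P),\phi(Q),\phi(R)$ lie on a common line of $\mathcal B$. Suppose that $\phi$ *preserves the order of intersection points on each line*: whenever $L\in\mathcal A$ and $M\in\mathcal B$ satisfy $\phi(\mathcal P_{\mathcal A}\cap L)\subseteq M$, there are linear coordinate systems $L=\{v+tw\mid t\in\mathbb F\}$ and $M=\{v'+tw'\mid t\in\mathbb F\}$ ($w,w'\neq 0$) such that $\phi$ is strictly increasing in these coordinates on $\mathcal P_{\mathcal A}\cap L$. (As each line carries two mutually inverse orders,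 the order may be preserved or reversed with respect to coordinates chosen in advance.) Then there is a piecewise-linear automorphism $f$ of $\mathbb F^2$ taking $\mathcal A$ to $\mathcal B$, that is, $\{f(L)\mid L\in\mathcal A\}=\mathcal B$. Here a map $\mathbb F^2\to\mathbb F^2$ is *piecewise linear* if $\mathbb F^2$ is a union of finitely many sets, each the solution set of finitely many weak affine inequalities, on each of which the map agrees with an affine map; a *piecewise-linear automorphism* is a bijection $f$ such that $f$ and $f^{-1}$ are piecewise linear. -/

import Mathlib

/-- A line in the plane `F²`: a one-dimensional affine subspace. -/
def IsPlaneLine {F : Type*} [Field F] (L : AffineSubspace F (F × F)) : Prop :=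
  Module.finrank F L.direction = 1

/-- A line arrangement: a finite set of lines, no two of them parallel, no three of them
concurrent. -/
structure IsLineArrangement {F : Type*} [Field F]
    (A : Finset (AffineSubspace F (F × F))) : Prop where
  isLine : ∀ L ∈ A, IsPlaneLine L
  not_parallel : ∀ L ∈ A, ∀ M ∈ A, L ≠ M → ¬ L.Parallel M
  not_concurrent : ∀ L ∈ A, ∀ M ∈ A, ∀ N ∈ A, L ≠ M → L ≠ N → M ≠ N →
    ¬ ∃ p : F × F, p ∈ L ∧ p ∈ M ∧ p ∈ N

/-- The set of intersection points of pairs of distinct lines of `A`. -/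
def intersectionPoints {F : Type*} [Field F]
    (A : Finset (AffineSubspace F (F × F))) : Set (F × F) :=
  {p | ∃ L ∈ A, ∃ M ∈ A, L ≠ M ∧ p ∈ L ∧ p ∈ M}

/-- A line arrangement collineation isomorphism from `A` to `B`: a bijection between the sets of
intersection points that sends any three distinct intersection points lying on a common line
of `A` to points lying on a common line of `B`. (Values of `φ` off the intersection points
of `A` play no role.) -/
structure IsLineArrangementCollineationIso {F : Type*} [Field F]
    (A B : Finset (AffineSubspace F (F × F))) (φ : F × F → F × F) : Prop where
  bijOn : Set.BijOn φ (intersectionPoints A) (intersectionPoints B)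
  collinear : ∀ P ∈ intersectionPoints A, ∀ Q ∈ intersectionPoints A,
    ∀ R ∈ intersectionPoints A, P ≠ Q → P ≠ R → Q ≠ R →
    (∃ L ∈ A, P ∈ L ∧ Q ∈ L ∧ R ∈ L) → ∃ M ∈ B, φ P ∈ M ∧ φ Q ∈ M ∧ φ R ∈ M

/-- `t ↦ v + t w` is a linear coordinate system on the line `L`. Such a system orders the points
of `L`; replacing `w` by `-w` gives the inverse order, and these are the only two orders
obtained. -/
def IsLineCoordinate {F : Type*} [Field F] (L : AffineSubspace F (F × F)) (v w : F × F) : Prop :=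
  w ≠ 0 ∧ (L : Set (F × F)) = Set.range (fun t : F => v + t • w)

/-- `φ` preserves the order of intersection points on each line: whenever `φ` sends the
intersection points on a line `L` of `A` to points of a line `M` of `B`, there are linear
coordinate systems on `L` and `M` in which `φ` is strictly increasing on the intersection points
of `L`. As each line carries two mutually inverse orders, this means that `φ` preserves
or reverses the order given by any fixed pair of coordinate systems. -/
def PreservesIntersectionOrder {F : Type*} [Field F] [LinearOrder F]
    (A B : Finset (AffineSubspace F (F × F))) (φ : F × F → F × F) : Prop :=
  ∀ L ∈ A, ∀ M ∈ B, (∀ P ∈ intersectionPoints A, P ∈ L → φ P ∈ M) →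
    ∃ v w v' w' : F × F, IsLineCoordinate L v w ∧ IsLineCoordinate M v' w' ∧
      ∀ s t s' t' : F, v + s • w ∈ intersectionPoints A → v + t • w ∈ intersectionPoints A →
        φ (v + s • w) = v' + s' • w' → φ (v + t • w) = v' + t' • w' → s < t → s' < t'

/-- A closed convex polyhedron in the plane: the set of solutions of finitely many weak
affine inequalities. -/
def IsPlanePolyhedron {F : Type*} [Field F] [LinearOrder F] (C : Set (F × F)) : Prop :=
  ∃ H : Finset ((F × F) →ᵃ[F] F), C = {p | ∀ h ∈ H, 0 ≤ h p}

/-- A map of the plane is piecewise linear if the plane is the union of finitely many closed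
convex polyhedra on each of which the map agrees with an affine map. (Since the pieces are closed,
such a map is automatically continuous for the order topology.) -/
def IsPiecewiseLinearMap {F : Type*} [Field F] [LinearOrder F] (f : F × F → F × F) : Prop :=
  ∃ 𝒞 : Set (Set (F × F)), 𝒞.Finite ∧ (∀ C ∈ 𝒞, IsPlanePolyhedron C) ∧ ⋃₀ 𝒞 = Set.univ ∧
    ∀ C ∈ 𝒞, ∃ g : (F × F) →ᵃ[F] (F × F), Set.EqOn f g C

/-- A piecewise linear automorphism of the plane: a bijection which is piecewise linear
together with its inverse. -/
def IsPiecewiseLinearAut {F : Type*} [Field F] [LinearOrder F] (f : (F × F) ≃ (F × F)) : Prop :=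
  IsPiecewiseLinearMap f ∧ IsPiecewiseLinearMap f.symm

/-- `f` takes the arrangement `A` to the arrangement `B`: the images of the lines of `A` are
exactly the lines of `B`. -/
def TakesArrangementTo {F : Type*} [Field F] (f : (F × F) ≃ (F × F))
    (A B : Finset (AffineSubspace F (F × F))) : Prop :=
  {S : Set (F × F) | ∃ L ∈ A, S = f '' (L : Set (F × F))} =
    {S : Set (F × F) | ∃ M ∈ B, S = (M : Set (F × F))}

/-! The map `φ` comes from a bijection of lines (`exists_line_equiv`). With at least three lines,
two intersection points of a line already determine where it goes, and counting gives injectivity;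
with at most two lines any bijection works. In coordinates on corresponding lines, `φ` is a strictly
increasing function on a finite set, so it extends to a piecewise linear order isomorphism of `F`.
These extensions agree at the crossings and define a bijection `ψ` between the unions of the two
families of lines.

The map `ψ` respects sides. Along one transversal, the sides of a line `M` correspond to those of
its image up to a sign, and two transversals give the same sign because they meet off `M`. After a
change of sign in the equations, cells correspond by sign vectors. Since `ψ` takes rays to rays, a
cell with an interior recession direction corresponds to another such cell.

Each closed cell is a cone over its boundary, from an interior point or from an interior recession
direction. Extending `ψ` along the segments or rays of this cone gives `coneMap`, whose inverse has
the same form. Two distinct cells meet only on lines, where both extensions equal `ψ`, so the pieces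
glue (`exists_isPiecewiseLinearAut_of_skeleton`). Coning from a point divides by a varying scalar,
yet stays piecewise linear because the homogenization `z * g (s / z)` of a sum of hinges is
piecewise linear. All arguments use finitely many inequalities, so they hold over any ordered field.
-/

/-! ### Piecewise linear maps, and order isomorphisms of the field -/

section PiecewiseLinear

variable {F : Type*} [Field F] [LinearOrder F]
  {V W : Type*} [AddCommGroup V] [Module F V] [AddCommGroup W] [Module F W]

/-- Piecewise linear maps from the plane to an arbitrary vector space. -/
def IsPLMap (f : F × F → V) : Prop :=
  ∃ 𝒞 : Set (Set (F × F)), 𝒞.Finite ∧ (∀ C ∈ 𝒞, IsPlanePolyhedron C) ∧ ⋃₀ 𝒞 = Set.univ ∧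
    ∀ C ∈ 𝒞, ∃ g : (F × F) →ᵃ[F] V, Set.EqOn f g C

theorem isPlanePolyhedron_univ : IsPlanePolyhedron (Set.univ : Set (F × F)) :=
  ⟨∅, by simp⟩

theorem IsPlanePolyhedron.inter {C D : Set (F × F)} (hC : IsPlanePolyhedron C)
    (hD : IsPlanePolyhedron D) : IsPlanePolyhedron (C ∩ D) := by
  classical
  obtain ⟨H, rfl⟩ := hC
  obtain ⟨K, rfl⟩ := hD
  refine ⟨H ∪ K, ?_⟩
  ext p
  simp only [Set.mem_inter_iff, Set.mem_ofPred_eq, Finset.mem_union]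
  constructor
  · rintro ⟨h1, h2⟩ h (hh | hh)
    exacts [h1 h hh, h2 h hh]
  · intro h
    exact ⟨fun k hk => h k (Or.inl hk), fun k hk => h k (Or.inr hk)⟩

theorem isPlanePolyhedron_of_fintype {ι : Type*} [Fintype ι] (h : ι → (F × F) →ᵃ[F] F) :
    IsPlanePolyhedron {p | ∀ i, 0 ≤ h i p} := by
  classical
  exact ⟨Finset.univ.image h, by simp⟩

theorem isPlanePolyhedron_halfPlane (h : (F × F) →ᵃ[F] F) :
    IsPlanePolyhedron {p | 0 ≤ h p} :=
  ⟨{h}, by simp⟩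

theorem IsPLMap.affine (g : (F × F) →ᵃ[F] V) : IsPLMap (g : F × F → V) :=
  ⟨{Set.univ}, by simp, by simpa using isPlanePolyhedron_univ, by simp,
    fun _ _ => ⟨g, fun _ _ => rfl⟩⟩

theorem IsPiecewiseLinearAut.refl : IsPiecewiseLinearAut (Equiv.refl (F × F)) :=
  ⟨IsPLMap.affine (AffineMap.id F (F × F)), IsPLMap.affine (AffineMap.id F (F × F))⟩

/-- Cutting each `C i` by the pieces of `G i` leaves finitely many polyhedra. -/
theorem IsPLMap.of_cover {ι : Type*} [Finite ι] {f : F × F → V} (C : ι → Set (F × F))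
    (hC : ∀ i, IsPlanePolyhedron (C i)) (hcov : ∀ x, ∃ i, x ∈ C i)
    (hf : ∀ i, ∃ G : F × F → V, IsPLMap G ∧ Set.EqOn f G (C i)) : IsPLMap f := by
  choose G hG hfG using hf
  choose 𝒟 hfin hpoly hcov' hg using hG
  refine ⟨⋃ i, (fun D => C i ∩ D) '' 𝒟 i, Set.finite_iUnion fun i => (hfin i).image _, ?_, ?_, ?_⟩
  · intro E hE
    obtain ⟨i, D, hD, rfl⟩ := Set.mem_iUnion.1 hE
    exact (hC i).inter (hpoly i D hD)
  · refine Set.eq_univ_of_forall fun x => ?_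
    obtain ⟨i, hi⟩ := hcov x
    obtain ⟨D, hD, hx⟩ := Set.mem_sUnion.1 (hcov' i ▸ Set.mem_univ x : x ∈ ⋃₀ 𝒟 i)
    exact ⟨_, Set.mem_iUnion.2 ⟨i, D, hD, rfl⟩, hi, hx⟩
  · intro E hE
    obtain ⟨i, D, hD, rfl⟩ := Set.mem_iUnion.1 hE
    obtain ⟨g, hgD⟩ := hg i D hD
    exact ⟨g, fun x hx => (hfG i hx.1).trans (hgD hx.2)⟩

theorem IsPLMap.linear_comp {f : F × F → V} (hf : IsPLMap f) (T : V →ₗ[F] W) :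
    IsPLMap (fun x => T (f x)) := by
  obtain ⟨𝒞, h1, h2, h3, h4⟩ := hf
  refine ⟨𝒞, h1, h2, h3, fun C hC => ?_⟩
  obtain ⟨g, hg⟩ := h4 C hC
  exact ⟨T.toAffineMap.comp g, fun x hx => by simp [hg hx]⟩

theorem IsPLMap.affine_add {f : F × F → V} (hf : IsPLMap f) (g : (F × F) →ᵃ[F] V) :
    IsPLMap (fun x => g x + f x) := by
  obtain ⟨𝒞, h1, h2, h3, h4⟩ := hf
  refine ⟨𝒞, h1, h2, h3, fun C hC => ?_⟩
  obtain ⟨k, hk⟩ := h4 C hC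
  exact ⟨g + k, fun x hx => by simp [hk hx]⟩

theorem IsPLMap.add {f g : F × F → V} (hf : IsPLMap f) (hg : IsPLMap g) :
    IsPLMap (fun x => f x + g x) := by
  obtain ⟨𝒞, h1, h2, h3, h4⟩ := hf
  have := h1.to_subtype
  refine IsPLMap.of_cover (fun C : 𝒞 => (C : Set (F × F))) (fun C => h2 C C.2) (fun x => ?_)
    fun C => ?_
  · obtain ⟨C, hC, hx⟩ := Set.mem_sUnion.1 (h3 ▸ Set.mem_univ x : x ∈ ⋃₀ 𝒞)
    exact ⟨⟨C, hC⟩, hx⟩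
  · obtain ⟨k, hk⟩ := h4 C C.2
    exact ⟨_, hg.affine_add k, fun x hx => by simp [hk hx]⟩

variable [IsStrictOrderedRing F]

theorem IsPLMap.hinge (a : (F × F) →ᵃ[F] F) : IsPLMap (fun x => max 0 (a x)) := by
  refine IsPLMap.of_cover (fun i : Bool => cond i {p | 0 ≤ a p} {p | 0 ≤ (-a) p})
    (by rintro (_ | _) <;> exact isPlanePolyhedron_halfPlane _) (fun x => ?_) ?_
  · rcases le_total 0 (a x) with h | h
    · exact ⟨true, h⟩
    · exact ⟨false, by simpa using h⟩
  · rintro (_ | _)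
    · refine ⟨_, IsPLMap.affine 0, fun x hx => ?_⟩
      have : a x ≤ 0 := by simpa using hx
      simpa using this
    · exact ⟨_, IsPLMap.affine a, fun x hx => max_eq_right hx⟩

/-- Piecewise linear functions on `F`, presented as an affine function plus a sum of hinges. -/
inductive IsHingeSum : (F → F) → Prop
  | affine (a b : F) : IsHingeSum (fun t => a * t + b)
  | add_hinge {g : F → F} (hg : IsHingeSum g) (k c : F) :
      IsHingeSum (fun t => g t + k * max 0 (t - c))

/-- The homogenization of a piecewise linear function is piecewise linear. -/
theorem IsHingeSum.exists_homogenization {g : F → F} (hg : IsHingeSum g)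
    (s z : (F × F) →ᵃ[F] F) :
    ∃ G : F × F → F, IsPLMap G ∧ ∀ x, (0 < z x → G x = z x * g (s x / z x)) ∧
      (z x = 0 → s x = 0 → G x = 0) := by
  induction hg with
  | affine a b =>
    refine ⟨_, IsPLMap.affine (a • s + b • z), fun x => ⟨fun hz => ?_, fun h1 h2 => ?_⟩⟩
    · simp
      field_simp
    · simp [h1, h2]
  | @add_hinge g hg k c ih =>
    obtain ⟨G, hG, h⟩ := ih
    -- For `z > 0` the factor `z` moves inside the maximum, so the hinge becomes `max 0 (s - c z)`,
    -- free of division.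
    refine ⟨_, hG.add ((IsPLMap.hinge (s - c • z)).linear_comp (LinearMap.mulLeft F k)),
      fun x => ⟨fun hz => ?_, fun h1 h2 => ?_⟩⟩
    · have : max 0 (s x - c * z x) = z x * max 0 (s x / z x - c) := by
        rw [mul_max_of_nonneg _ _ hz.le]
        congr 1
        · simp
        · field_simp
      simp [(h x).1 hz, this]
      ring
    · simp [(h x).2 h1 h2, h1, h2]

/-- Points are added from left to right. Beyond the last point `s` the slope is `γ`; a hinge at `s`
changes it to the slope `δ` that reaches the new value, and a hinge at `g s` with coefficient `1 / δ
- 1 / γ` corrects the inverse. The last clause keeps track of the final slope for the induction. -/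
theorem exists_isHingeSum_extension (S : Finset F) (ψ : F → F) (hψ : StrictMonoOn ψ S) :
    ∃ g g' : F → F, IsHingeSum g ∧ IsHingeSum g' ∧ StrictMono g ∧ (∀ t, g' (g t) = t) ∧
      (∀ t, g (g' t) = t) ∧ (∀ t ∈ S, g t = ψ t) ∧
      ∃ γ : F, 0 < γ ∧ ∀ s ∈ S, (∀ t ∈ S, t ≤ s) → ∀ t, s ≤ t → g t = g s + γ * (t - s) := by
  induction S using Finset.induction_on_max with
  | empty =>
    refine ⟨_, _, .affine 1 0, .affine 1 0, fun a b h => by simpa using h, by simp, by simp,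
      by simp, 1, by simp, by simp⟩
  | insert a S hS ih =>
    obtain ⟨g, g', hg, hg', hmono, hl, hr, hgS, γ, hγ, hlin⟩ :=
      ih (hψ.mono (by simp))
    rcases S.eq_empty_or_nonempty with rfl | hne
    · refine ⟨_, _, .affine 1 (ψ a - a), .affine 1 (a - ψ a), fun a b h => by simpa using h,
        fun t => by ring, fun t => by ring, by simp, 1, by simp, fun s hs _ t _ => by ring⟩
    · set s := S.max' hne with hs
      have hsS : s ∈ S := S.max'_mem hne
      have hsa : s < a := hS s hsS
      have hglin := hlin s hsS (fun t ht => S.le_max' t ht)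
      have hψsa : ψ s < ψ a := hψ (by simp [hsS]) (by simp) hsa
      set δ := (ψ a - ψ s) / (a - s) with hδ
      have hδ0 : 0 < δ := div_pos (sub_pos.2 hψsa) (sub_pos.2 hsa)
      have hlow : ∀ t, t ≤ s → g t + (δ - γ) * max 0 (t - s) = g t := fun t ht => by
        rw [max_eq_left (sub_nonpos.2 ht)]; simp
      have hhigh : ∀ t, s ≤ t → g t + (δ - γ) * max 0 (t - s) = g s + δ * (t - s) :=
        fun t ht => by
          rw [max_eq_right (sub_nonneg.2 ht), hglin t ht]; ring
      have hlow' : ∀ t, t ≤ g s → g' t + (1 / δ - 1 / γ) * max 0 (t - g s) = g' t :=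
        fun t ht => by
          rw [max_eq_left (sub_nonpos.2 ht)]; simp
      have hhigh' : ∀ t, g s ≤ t →
          g' t + (1 / δ - 1 / γ) * max 0 (t - g s) = s + (t - g s) / δ := fun t ht => by
        have h1 : s ≤ s + (t - g s) / γ := by
          have := div_nonneg (sub_nonneg.2 ht) hγ.le
          linarith
        have h2 : g (s + (t - g s) / γ) = t := by
          rw [hglin _ h1]; field_simp; ring
        have h3 : g' t = s + (t - g s) / γ := by rw [← hl (s + (t - g s) / γ), h2]
        rw [max_eq_right (sub_nonneg.2 ht), h3]; ring
      refine ⟨_, _, hg.add_hinge (δ - γ) s, hg'.add_hinge (1 / δ - 1 / γ) (g s), ?_, ?_, ?_, ?_,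
        δ, hδ0, ?_⟩
      · intro t u htu
        show g t + (δ - γ) * max 0 (t - s) < g u + (δ - γ) * max 0 (u - s)
        rcases le_total u s with h | h
        · rw [hlow t (htu.le.trans h), hlow u h]; exact hmono htu
        · rw [hhigh u h]
          rcases le_total t s with h' | h'
          · rw [hlow t h']
            rcases h'.lt_or_eq with h'' | h''
            · have := hmono h''
              have := mul_nonneg hδ0.le (sub_nonneg.2 h)
              linarith
            · subst h''
              have := mul_pos hδ0 (sub_pos.2 htu)
              linarith
          · rw [hhigh t h']
            have := mul_lt_mul_of_pos_left htu hδ0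
            linarith
      · intro t
        show g' (g t + (δ - γ) * max 0 (t - s)) +
          (1 / δ - 1 / γ) * max 0 (g t + (δ - γ) * max 0 (t - s) - g s) = t
        rcases le_total t s with h | h
        · rw [hlow t h, hlow' _ (hmono.monotone h), hl]
        · rw [hhigh t h, hhigh' _ (by have := mul_nonneg hδ0.le (sub_nonneg.2 h); linarith)]
          field_simp; ring
      · intro t
        show g (g' t + (1 / δ - 1 / γ) * max 0 (t - g s)) +
          (δ - γ) * max 0 (g' t + (1 / δ - 1 / γ) * max 0 (t - g s) - s) = t
        rcases le_total t (g s) with h | h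
        · have h' : g' t ≤ s := by
            rw [← hmono.le_iff_le, hr]; exact h
          rw [hlow' t h, hlow _ h', hr]
        · rw [hhigh' t h, hhigh _ (by have := div_nonneg (sub_nonneg.2 h) hδ0.le; linarith)]
          field_simp; ring
      · intro t ht
        show g t + (δ - γ) * max 0 (t - s) = ψ t
        rcases Finset.mem_insert.1 ht with rfl | ht
        · rw [hhigh _ hsa.le, hgS s hsS, hδ]
          have : t - s ≠ 0 := (sub_pos.2 hsa).ne'
          field_simp; ring
        · rw [hlow t (S.le_max' t ht), hgS t ht]
      · intro r hr' hmax t ht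
        have hra : r = a := by
          rcases Finset.mem_insert.1 hr' with h | h
          · exact h
          · exact absurd (hmax a (by simp)) (not_le.2 (hS r h))
        subst hra
        show g t + (δ - γ) * max 0 (t - s) = g r + (δ - γ) * max 0 (r - s) + δ * (t - r)
        rw [hhigh t (hsa.le.trans ht), hhigh r hsa.le]
        ring

/-- A strictly increasing function on a finite set extends to a piecewise linear
order isomorphism. -/
theorem exists_orderIso_extension (S : Finset F) (ψ : F → F) (hψ : StrictMonoOn ψ S) :
    ∃ g : F ≃o F, IsHingeSum g ∧ IsHingeSum g.symm ∧ ∀ t ∈ S, g t = ψ t := by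
  obtain ⟨g, g', hg, hg', hmono, hl, hr, hgS, -⟩ := exists_isHingeSum_extension S ψ hψ
  exact ⟨⟨⟨g, g', hl, hr⟩, hmono.le_iff_le⟩, hg, hg', hgS⟩

end PiecewiseLinear

/-! ### Cells of an arrangement, their facets and poles -/

section Cells

variable {F : Type*} [Field F] {ι : Type*}

theorem affineMap_add_apply (m : (F × F) →ᵃ[F] F) (x d : F × F) :
    m (x + d) = m x + m.linear d := by
  have := m.map_vadd x d
  rw [vadd_eq_add, vadd_eq_add] at this
  rw [add_comm x d, this, add_comm]

theorem affineMap_add_smul_apply (m : (F × F) →ᵃ[F] F) (x d : F × F) (s : F) :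
    m (x + s • d) = m x + s * m.linear d := by
  rw [affineMap_add_apply, map_smul, smul_eq_mul]

theorem affineMap_eq_linear_add (m : (F × F) →ᵃ[F] F) (x : F × F) :
    m x = m.linear x + m 0 := by
  have := affineMap_add_apply m 0 x
  rw [zero_add] at this
  rw [this, add_comm]

/-- The zero sets of the affine functions `ℓ i` are lines in pairwise different directions. -/
structure DistinctDirections (ℓ : ι → (F × F) →ᵃ[F] F) : Prop where
  nonconstant : ∀ i, ∃ d, (ℓ i).linear d ≠ 0
  indep : ∀ i j, i ≠ j → ∀ d, (ℓ i).linear d = 0 → (ℓ j).linear d = 0 → d = 0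

theorem exists_ne_zero_apply_eq_zero (L : (F × F) →ₗ[F] F) : ∃ d, d ≠ 0 ∧ L d = 0 := by
  by_cases h : L (0, 1) = 0
  · exact ⟨(0, 1), by simp, h⟩
  · refine ⟨L (0, 1) • (1, 0) - L (1, 0) • (0, 1), fun h' => h ?_, ?_⟩
    · simpa using congrArg Prod.fst h'
    · rw [map_sub, map_smul, map_smul, smul_eq_mul, smul_eq_mul, mul_comm, sub_self]

theorem exists_apply_eq_zero {ℓ : ι → (F × F) →ᵃ[F] F} (h : DistinctDirections ℓ) (i : ι) :
    ∃ y, ℓ i y = 0 := by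
  obtain ⟨d, hd⟩ := h.nonconstant i
  refine ⟨0 + (-(ℓ i 0) / (ℓ i).linear d) • d, ?_⟩
  rw [affineMap_add_smul_apply]
  field_simp
  ring

variable [LinearOrder F]

/-- `ψ` maps the lines `ℓ i = 0` to the lines `ℓ' i = 0`, piecewise linearly, compatibly with the
sides of all lines, and maps rays of each line to rays. -/
structure IsSkeletonMap (ℓ ℓ' : ι → (F × F) →ᵃ[F] F) (ψ : F × F → F × F) : Prop where
  sign_eq : ∀ i j x, ℓ i x = 0 → SignType.sign (ℓ' j (ψ x)) = SignType.sign (ℓ j x)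
  ray : ∀ i d, d ≠ 0 → (ℓ i).linear d = 0 → ∃ d', d' ≠ 0 ∧ (ℓ' i).linear d' = 0 ∧
    ∀ y, ℓ i y = 0 → ∀ s' : F, 0 ≤ s' → ∃ s : F, ψ (y + s • d) = ψ y + s' • d' ∧ 0 ≤ s
  homogenization : ∀ i (s : (F × F) →ᵃ[F] (F × F)) (z : (F × F) →ᵃ[F] F),
    ∃ G : F × F → F × F, IsPLMap G ∧ ∀ x,
      (0 < z x → ℓ i ((z x)⁻¹ • s x) = 0 → G x = z x • ψ ((z x)⁻¹ • s x)) ∧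
      (z x = 0 → s x = 0 → G x = 0)

theorem IsSkeletonMap.pos_iff {ℓ ℓ' : ι → (F × F) →ᵃ[F] F} {ψ : F × F → F × F}
    (hψ : IsSkeletonMap ℓ ℓ' ψ) {i : ι} {x : F × F} (hx : ℓ i x = 0)
    (j : ι) : 0 < ℓ' j (ψ x) ↔ 0 < ℓ j x := by
  rw [← sign_eq_one_iff, ← sign_eq_one_iff, hψ.sign_eq i j x hx]

theorem IsSkeletonMap.eq_zero_iff {ℓ ℓ' : ι → (F × F) →ᵃ[F] F} {ψ : F × F → F × F}
    (hψ : IsSkeletonMap ℓ ℓ' ψ) {i : ι} {x : F × F}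
    (hx : ℓ i x = 0) (j : ι) : ℓ' j (ψ x) = 0 ↔ ℓ j x = 0 := by
  rw [← sign_eq_zero_iff, hψ.sign_eq i j x hx, sign_eq_zero_iff]

theorem IsSkeletonMap.nonneg {ℓ ℓ' : ι → (F × F) →ᵃ[F] F} {ψ : F × F → F × F}
    (hψ : IsSkeletonMap ℓ ℓ' ψ) {i : ι} {x : F × F}
    (hx : ℓ i x = 0) {j : ι} (hj : 0 ≤ ℓ j x) : 0 ≤ ℓ' j (ψ x) := by
  rcases hj.eq_or_lt with h | h
  · exact ((hψ.eq_zero_iff hx j).2 h.symm).ge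
  · exact ((hψ.pos_iff hx j).2 h).le

variable [IsStrictOrderedRing F]

theorem exists_linear_pos {ℓ : ι → (F × F) →ᵃ[F] F} (h : DistinctDirections ℓ) (i : ι) :
    ∃ d, 0 < (ℓ i).linear d := by
  obtain ⟨d, hd⟩ := h.nonconstant i
  rcases hd.lt_or_gt with hd | hd
  · exact ⟨-d, by simpa using hd⟩
  · exact ⟨d, hd⟩

/-- A small step keeps strict inequalities and makes an equality strict where the slope is positive.
The induction carries a whole interval of admissible steps, so that bounds combine by `min`. -/
theorem exists_pos_forall_add_mul_pos [Finite ι] (a c : ι → F)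
    (h : ∀ j, 0 < a j ∨ (a j = 0 ∧ 0 < c j)) : ∃ s, 0 < s ∧ ∀ j, 0 < a j + s * c j := by
  have := Fintype.ofFinite ι
  suffices H : ∀ T : Finset ι, ∃ r : F, 0 < r ∧ ∀ s, 0 < s → s ≤ r → ∀ j ∈ T, 0 < a j + s * c j by
    obtain ⟨r, hr, H⟩ := H Finset.univ
    exact ⟨r, hr, fun j => H r hr le_rfl j (Finset.mem_univ j)⟩
  classical
  intro T
  induction T using Finset.induction_on with
  | empty => exact ⟨1, one_pos, by simp⟩
  | insert j T hj ih =>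
    obtain ⟨r, hr, H⟩ := ih
    obtain ⟨r', hr', H'⟩ : ∃ r' : F, 0 < r' ∧ ∀ s, 0 < s → s ≤ r' → 0 < a j + s * c j := by
      rcases h j with h | ⟨h, h'⟩
      · have hc : 0 < |c j| + 1 := by positivity
        refine ⟨a j / (|c j| + 1), div_pos h hc, fun s hs hs' => ?_⟩
        rw [le_div_iff₀ hc] at hs'
        have := mul_le_mul_of_nonneg_left (neg_abs_le (c j)) hs.le
        linarith
      · exact ⟨1, one_pos, fun s hs _ => by rw [h, zero_add]; exact mul_pos hs h'⟩
    refine ⟨min r r', lt_min hr hr', fun s hs hs' k hk => ?_⟩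
    rcases Finset.mem_insert.1 hk with rfl | hk
    · exact H' s hs (hs'.trans (min_le_right _ _))
    · exact H s hs (hs'.trans (min_le_left _ _)) k hk

theorem DistinctDirections.exists_forall_linear_ne_zero [Finite ι] {ℓ : ι → (F × F) →ᵃ[F] F}
    (h : DistinctDirections ℓ) : ∃ e, ∀ i, (ℓ i).linear e ≠ 0 :=
  Module.Dual.exists_forall_ne_zero_of_forall_exists (fun i => (ℓ i).linear) h.nonconstant

/-- A nonempty open cell of a line arrangement has a facet. -/
theorem DistinctDirections.exists_facet_point [Finite ι] [Nonempty ι]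
    {ℓ : ι → (F × F) →ᵃ[F] F} (h : DistinctDirections ℓ) {x : F × F} (hx : ∀ i, 0 < ℓ i x) :
    ∃ i y, ℓ i y = 0 ∧ ∀ j, j ≠ i → 0 < ℓ j y := by
  have := Fintype.ofFinite ι
  obtain ⟨i₀⟩ := ‹Nonempty ι›
  -- A generic direction: the ray from `x` never meets two lines at the same time, and by the `none`
  -- entry it is not parallel to line `i₀`.
  obtain ⟨e₁, he₁⟩ := Module.Dual.exists_forall_ne_zero_of_forall_exists
    (fun p : Option {p : ι × ι // p.1 ≠ p.2} => p.elim (ℓ i₀).linear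
      fun q => ℓ q.1.1 x • (ℓ q.1.2).linear - ℓ q.1.2 x • (ℓ q.1.1).linear) (by
      rintro (_ | ⟨⟨j, k⟩, hjk⟩)
      · exact h.nonconstant i₀
      · obtain ⟨d, hd, hd'⟩ := exists_ne_zero_apply_eq_zero (ℓ j).linear
        refine ⟨d, ?_⟩
        have : (ℓ k).linear d ≠ 0 := fun h' => hd (h.indep j k hjk d hd' h')
        simpa [hd'] using ⟨(hx j).ne', this⟩)
  obtain ⟨e, he₀, he⟩ : ∃ e, (ℓ i₀).linear e < 0 ∧
      ∀ j k, j ≠ k → ℓ j x * (ℓ k).linear e - ℓ k x * (ℓ j).linear e ≠ 0 := by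
    have h1 : ∀ j k, j ≠ k → ℓ j x * (ℓ k).linear e₁ - ℓ k x * (ℓ j).linear e₁ ≠ 0 :=
      fun j k hjk => he₁ (some ⟨(j, k), hjk⟩)
    have h2 : (ℓ i₀).linear e₁ ≠ 0 := he₁ none
    rcases h2.lt_or_gt with h3 | h3
    · exact ⟨e₁, h3, h1⟩
    · refine ⟨-e₁, by simpa using h3, fun j k hjk h4 => h1 j k hjk ?_⟩
      simp only [map_neg] at h4
      linear_combination -h4
  -- Line `i` is the first one that the ray hits.
  obtain ⟨i, hi, hmin⟩ := Finset.exists_min_image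
    (Finset.univ.filter fun j => (ℓ j).linear e < 0) (fun j => ℓ j x / -(ℓ j).linear e)
    ⟨i₀, by simpa using he₀⟩
  have hi' : (ℓ i).linear e < 0 := by simpa using hi
  set s := ℓ i x / -(ℓ i).linear e with hs
  have hs0 : 0 < s := div_pos (hx i) (neg_pos.2 hi')
  have hsi : ℓ i x + s * (ℓ i).linear e = 0 := by
    rw [hs, div_neg, neg_mul, div_mul_cancel₀ _ hi'.ne, add_neg_cancel]
  refine ⟨i, x + s • e, by rw [affineMap_add_smul_apply, hsi], fun j hj => ?_⟩
  rw [affineMap_add_smul_apply]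
  have hne : ℓ j x + s * (ℓ j).linear e ≠ 0 := fun h0 => he j i hj (by
    linear_combination (ℓ i).linear e * h0 - (ℓ j).linear e * hsi)
  refine lt_of_le_of_ne ?_ hne.symm
  rcases lt_or_ge ((ℓ j).linear e) 0 with hj' | hj'
  · have := hmin j (by simpa using hj')
    rw [le_div_iff₀ (neg_pos.2 hj')] at this
    linarith
  · have := mul_nonneg hs0.le hj'
    have := hx j
    linarith

variable {ℓ ℓ' : ι → (F × F) →ᵃ[F] F} {ψ : F × F → F × F}

/-- The image of a facet point lies on one line and on the positive side of the others; a small push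
off that line enters the target cell. -/
theorem IsSkeletonMap.exists_forall_pos [Finite ι] [Nonempty ι] (hψ : IsSkeletonMap ℓ ℓ' ψ)
    (hℓ : DistinctDirections ℓ) (hℓ' : DistinctDirections ℓ') {x : F × F}
    (hx : ∀ i, 0 < ℓ i x) : ∃ x', ∀ i, 0 < ℓ' i x' := by
  obtain ⟨i, y, hy, hpos⟩ := hℓ.exists_facet_point hx
  obtain ⟨e, he⟩ := exists_linear_pos hℓ' i
  obtain ⟨s, -, hs⟩ := exists_pos_forall_add_mul_pos (fun j => ℓ' j (ψ y))
    (fun j => (ℓ' j).linear e) (fun j => by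
      by_cases hj : j = i
      · subst hj
        exact Or.inr ⟨(hψ.eq_zero_iff hy j).2 hy, he⟩
      · exact Or.inl ((hψ.pos_iff hy j).2 (hpos j hj)))
  exact ⟨ψ y + s • e, fun j => by rw [affineMap_add_smul_apply]; exact hs j⟩

/-- The recession cone has a facet, spanned by a direction along some line `i`. A far ray of that
line is positive for all other `ℓ j`, and so is its image ray for `ℓ' j`. A function positive on a
whole ray has no negative slope, and slope zero would make two lines parallel. A small push then
makes all slopes positive. -/
theorem IsSkeletonMap.exists_forall_linear_pos [Finite ι] [Nonempty ι]
    (hψ : IsSkeletonMap ℓ ℓ' ψ) (hℓ : DistinctDirections ℓ) (hℓ' : DistinctDirections ℓ')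
    {d : F × F} (hd : ∀ i, 0 < (ℓ i).linear d) : ∃ d', ∀ i, 0 < (ℓ' i).linear d' := by
  have hlin : DistinctDirections fun i => (ℓ i).linear.toAffineMap :=
    ⟨hℓ.nonconstant, hℓ.indep⟩
  obtain ⟨i, d₀, hd₀, hpos⟩ := hlin.exists_facet_point (x := d) hd
  replace hd₀ : (ℓ i).linear d₀ = 0 := hd₀
  replace hpos : ∀ j, j ≠ i → 0 < (ℓ j).linear d₀ := hpos
  obtain ⟨e, he⟩ := exists_linear_pos hℓ' i
  suffices H : ∃ d', (ℓ' i).linear d' = 0 ∧ ∀ j, j ≠ i → 0 < (ℓ' j).linear d' by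
    obtain ⟨d', h0, h1⟩ := H
    obtain ⟨s, -, hs⟩ := exists_pos_forall_add_mul_pos (fun j => (ℓ' j).linear d')
      (fun j => (ℓ' j).linear e) (fun j => by
        by_cases hj : j = i
        · subst hj; exact Or.inr ⟨h0, he⟩
        · exact Or.inl (h1 j hj))
    exact ⟨d' + s • e, fun j => by simpa using hs j⟩
  by_cases hj : ∃ j, j ≠ i
  · obtain ⟨j₀, hj₀⟩ := hj
    have hd₀' : d₀ ≠ 0 := fun h0 => by simpa [h0] using hpos j₀ hj₀
    obtain ⟨y₀, hy₀⟩ := exists_apply_eq_zero hℓ i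
    obtain ⟨r, hr, hr'⟩ := exists_pos_forall_add_mul_pos
      (fun j : {j // j ≠ i} => (ℓ j).linear d₀) (fun j => ℓ j y₀) fun j => Or.inl (hpos j j.2)
    have hon : ∀ s : F, ℓ i (y₀ + s • d₀) = 0 := fun s => by
      rw [affineMap_add_smul_apply, hy₀, hd₀]; simp
    -- Dividing `(ℓ j).linear d₀ + r * ℓ j y₀ > 0` by `r` shows that the parameter `r⁻¹` is far
    -- enough out.
    set y := y₀ + r⁻¹ • d₀ with hy
    have hray : ∀ s : F, 0 ≤ s → ∀ j, j ≠ i → 0 < ℓ j (y + s • d₀) := fun s hs j hj => by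
      have h1 := mul_pos (inv_pos.2 hr) (hr' ⟨j, hj⟩)
      have h2 := mul_nonneg hs (hpos j hj).le
      rw [mul_add, inv_mul_cancel_left₀ hr.ne'] at h1
      rw [hy, affineMap_add_smul_apply, affineMap_add_smul_apply]
      linarith
    obtain ⟨d', hd'0, hd', hd'ray⟩ := hψ.ray i d₀ hd₀' hd₀
    refine ⟨d', hd', fun j hj => ?_⟩
    have hpos' : ∀ s' : F, 0 ≤ s' → 0 < ℓ' j (ψ y) + s' * (ℓ' j).linear d' := fun s' hs' => by
      obtain ⟨s, hs, hs0⟩ := hd'ray y (hon _) s' hs'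
      have hons : ℓ i (y + s • d₀) = 0 := by rw [affineMap_add_smul_apply, hon, hd₀]; simp
      rw [← affineMap_add_smul_apply, ← hs, hψ.pos_iff hons]
      exact hray s hs0 j hj
    rcases lt_trichotomy ((ℓ' j).linear d') 0 with h | h | h
    · have h1 : 0 < ℓ' j (ψ y) := by simpa using hpos' 0 le_rfl
      have h2 := hpos' _ (div_nonneg h1.le (neg_pos.2 h).le)
      have h3 : ℓ' j (ψ y) + ℓ' j (ψ y) / -(ℓ' j).linear d' * (ℓ' j).linear d' = 0 := by
        rw [div_neg, neg_mul, div_mul_cancel₀ _ h.ne, add_neg_cancel]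
      exact absurd h2 h3.not_gt
    · exact absurd (hℓ'.indep i j hj.symm d' hd' h) hd'0
    · exact h
  · push Not at hj
    exact ⟨0, by simp, fun j hj' => absurd (hj j) hj'⟩

/-- The linear extension of `ℓ i` to the homogenized plane. -/
def homogenized (ℓ : ι → (F × F) →ᵃ[F] F) (ζ : F) (b : F × F) (i : ι) : F :=
  (ℓ i).linear b + ζ * ℓ i 0

/-- An interior point `b` (if `ζ = 1`), or an interior direction `b` of recession (if `ζ = 0`),
of the cell of points at which all `ℓ i` are positive, from which the cell is a cone over its
boundary. -/
structure IsPole (ℓ : ι → (F × F) →ᵃ[F] F) (ζ : F) (b : F × F) : Prop where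
  pos : ∀ i, 0 < homogenized ℓ ζ b i
  le_one : ∀ x t, (∀ i, t * homogenized ℓ ζ b i ≤ ℓ i x) → t * ζ ≤ 1
  eq_of_eq_one : ∀ x t, (∀ i, t * homogenized ℓ ζ b i ≤ ℓ i x) → t * ζ = 1 → x = t • b

theorem IsPole.of_direction {b : F × F} (hb : ∀ i, 0 < (ℓ i).linear b) : IsPole ℓ 0 b :=
  ⟨fun i => by simpa [homogenized] using hb i, fun x t _ => by simp, fun x t _ h => by simp at h⟩

/-- Along a nonzero recession direction at most one linear part vanishes, so a small push would give
an interior one. Hence there is none, and `x = b` follows as soon as `x - b` is a recession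
direction. -/
theorem IsPole.of_bounded [Finite ι] [Nonempty ι] (hℓ : DistinctDirections ℓ)
    (hbdd : ¬ ∃ d, ∀ i, 0 < (ℓ i).linear d) {b : F × F} (hb : ∀ i, 0 < ℓ i b) :
    IsPole ℓ 1 b := by
  have hhat : ∀ i, homogenized ℓ 1 b i = ℓ i b := fun i => by
    rw [homogenized, one_mul, ← affineMap_eq_linear_add]
  have hrec : ∀ d, (∀ i, 0 ≤ (ℓ i).linear d) → d = 0 := by
    intro d hd
    by_contra hd0
    apply hbdd
    obtain ⟨i, hi⟩ : ∃ i, ∀ j, j ≠ i → 0 < (ℓ j).linear d := by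
      by_cases h : ∃ i, (ℓ i).linear d = 0
      · obtain ⟨i, hi⟩ := h
        exact ⟨i, fun j hj => lt_of_le_of_ne (hd j)
          fun h0 => hd0 (hℓ.indep i j hj.symm d hi h0.symm)⟩
      · push Not at h
        obtain ⟨i⟩ := ‹Nonempty ι›
        exact ⟨i, fun j _ => lt_of_le_of_ne (hd j) (h j).symm⟩
    obtain ⟨e, he⟩ := exists_linear_pos hℓ i
    obtain ⟨s, -, hs⟩ := exists_pos_forall_add_mul_pos (fun j => (ℓ j).linear d)
      (fun j => (ℓ j).linear e) (fun j => by
        by_cases hj : j = i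
        · subst hj
          rcases (hd j).eq_or_lt with h | h
          · exact Or.inr ⟨h.symm, he⟩
          · exact Or.inl h
        · exact Or.inl (hi j hj))
    exact ⟨d + s • e, fun j => by simpa using hs j⟩
  have key : ∀ x t, (∀ i, t * homogenized ℓ 1 b i ≤ ℓ i x) → 1 ≤ t → x = b := by
    intro x t h ht
    rw [← sub_eq_zero]
    refine hrec _ fun i => ?_
    have h1 := h i
    have h2 := mul_le_mul_of_nonneg_right ht (hb i).le
    rw [hhat] at h1
    have h3 := affineMap_add_apply (ℓ i) b (x - b)
    rw [add_sub_cancel] at h3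
    linarith
  refine ⟨fun i => by rw [hhat]; exact hb i, fun x t h => ?_, fun x t h ht => ?_⟩
  · rw [mul_one]
    by_contra! ht
    obtain rfl := key x t h ht.le
    obtain ⟨i⟩ := ‹Nonempty ι›
    have h1 := h i
    rw [hhat] at h1
    have := mul_lt_mul_of_pos_right ht (hb i)
    linarith
  · rw [mul_one] at ht
    rw [key x t h ht.ge, ht, one_smul]

/-- The two poles must be of the same kind `ζ`; this is why recession directions have to transfer
both ways. -/
theorem exists_isPole_isPole [Finite ι] [Nonempty ι] {ψ' : F × F → F × F}
    (hψ : IsSkeletonMap ℓ ℓ' ψ) (hψ' : IsSkeletonMap ℓ' ℓ ψ')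
    (hℓ : DistinctDirections ℓ) (hℓ' : DistinctDirections ℓ') {x : F × F}
    (hx : ∀ i, 0 < ℓ i x) : ∃ ζ b b', IsPole ℓ ζ b ∧ IsPole ℓ' ζ b' := by
  by_cases hd : ∃ d, ∀ i, 0 < (ℓ i).linear d
  · obtain ⟨d, hd⟩ := hd
    obtain ⟨d', hd'⟩ := hψ.exists_forall_linear_pos hℓ hℓ' hd
    exact ⟨0, d, d', .of_direction hd, .of_direction hd'⟩
  · obtain ⟨x', hx'⟩ := hψ.exists_forall_pos hℓ hℓ' hx
    refine ⟨1, x, x', .of_bounded hℓ hd hx, .of_bounded hℓ' ?_ hx'⟩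
    rintro ⟨d', hd'⟩
    exact hd (hψ'.exists_forall_linear_pos hℓ' hℓ hd')

end Cells

/-! ### Coning a boundary map to a cell -/

section ConeMap

variable {F : Type*} [Field F] {ι : Type*}

theorem apply_smul_add_smul (ℓ : ι → (F × F) →ᵃ[F] F) (ζ : F) (b y : F × F) (t : F) (i : ι) :
    ℓ i (t • b + (1 - t * ζ) • y) = t * homogenized ℓ ζ b i + (1 - t * ζ) * ℓ i y := by
  rw [affineMap_eq_linear_add (ℓ i) y, affineMap_eq_linear_add (ℓ i) (t • b + _), homogenized]
  simp only [map_add, map_smul, smul_eq_mul]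
  ring

variable [LinearOrder F]
  {ℓ ℓ' : ι → (F × F) →ᵃ[F] F} {ψ ψ' : F × F → F × F} {ζ : F} {b b' : F × F}

section Height

variable [Fintype ι] [Nonempty ι]

/-- The largest multiple of the pole `b` that can be split off `x` within the cell. -/
def coneHeight (ℓ : ι → (F × F) →ᵃ[F] F) (ζ : F) (b x : F × F) : F :=
  Finset.univ.inf' Finset.univ_nonempty fun i => ℓ i x / homogenized ℓ ζ b i

theorem IsPole.exists_coneHeight_mul_eq (hb : IsPole ℓ ζ b) (x : F × F) :
    ∃ i, coneHeight ℓ ζ b x * homogenized ℓ ζ b i = ℓ i x := by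
  obtain ⟨i, -, hi⟩ := Finset.exists_mem_eq_inf' Finset.univ_nonempty
    fun i => ℓ i x / homogenized ℓ ζ b i
  exact ⟨i, by rw [coneHeight, hi, div_mul_cancel₀ _ (hb.pos i).ne']⟩

variable [IsStrictOrderedRing F]

theorem IsPole.coneHeight_mul_le (hb : IsPole ℓ ζ b) (x : F × F) (i : ι) :
    coneHeight ℓ ζ b x * homogenized ℓ ζ b i ≤ ℓ i x := by
  rw [← le_div_iff₀ (hb.pos i)]
  exact Finset.inf'_le _ (Finset.mem_univ i)

theorem IsPole.coneHeight_eq (hb : IsPole ℓ ζ b) {x : F × F} {t : F}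
    (hle : ∀ i, t * homogenized ℓ ζ b i ≤ ℓ i x) {i : ι}
    (hi : t * homogenized ℓ ζ b i = ℓ i x) : coneHeight ℓ ζ b x = t := by
  apply le_antisymm
  · have := hb.coneHeight_mul_le x i
    rw [← hi] at this
    exact le_of_mul_le_mul_right this (hb.pos i)
  · obtain ⟨j, hj⟩ := hb.exists_coneHeight_mul_eq x
    have := hle j
    rw [← hj] at this
    exact le_of_mul_le_mul_right this (hb.pos j)

/-- The extension of `ψ` from the boundary of a cell to the cell, linear along the segments (or
rays) that join the boundary to the pole `b`. -/
def coneMap (ℓ : ι → (F × F) →ᵃ[F] F) (ζ : F) (b b' : F × F) (ψ : F × F → F × F)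
    (x : F × F) : F × F :=
  coneHeight ℓ ζ b x • b' + (1 - coneHeight ℓ ζ b x * ζ) •
    ψ ((1 - coneHeight ℓ ζ b x * ζ)⁻¹ • (x - coneHeight ℓ ζ b x • b))

theorem IsPole.coneHeight_nonneg (hb : IsPole ℓ ζ b) {x : F × F} (hx : ∀ i, 0 ≤ ℓ i x) :
    0 ≤ coneHeight ℓ ζ b x := by
  obtain ⟨i, hi⟩ := hb.exists_coneHeight_mul_eq x
  have := hx i
  rw [← hi] at this
  exact nonneg_of_mul_nonneg_left this (hb.pos i)

/-- Write `x = t b + (1 - t ζ) y` with `y` on the boundary. Its image `t b' + (1 - t ζ) ψ y` has the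
same height `t`, because `ψ` preserves sides, so the reverse cone map recovers `t` and then `y`. -/
theorem coneMap_spec (hb : IsPole ℓ ζ b) (hb' : IsPole ℓ' ζ b') (hψ : IsSkeletonMap ℓ ℓ' ψ)
    (hinv : ∀ i y, ℓ i y = 0 → ψ' (ψ y) = y) {x : F × F} (hx : ∀ i, 0 ≤ ℓ i x) :
    (∀ i, 0 ≤ ℓ' i (coneMap ℓ ζ b b' ψ x)) ∧
      coneMap ℓ' ζ b' b ψ' (coneMap ℓ ζ b b' ψ x) = x := by
  have ht := hb.coneHeight_nonneg hx
  have hle := hb.coneHeight_mul_le x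
  obtain ⟨i, hi⟩ := hb.exists_coneHeight_mul_eq x
  have hone := hb.le_one x _ hle
  have heq := hb.eq_of_eq_one x _ hle
  set x' := coneMap ℓ ζ b b' ψ x with hx'
  rw [coneMap] at hx'
  set t := coneHeight ℓ ζ b x
  -- If `t ζ = 1`, then `x = t b` is the apex, and the value of `ψ` is multiplied by zero.
  rcases hone.eq_or_lt with h1 | h1
  · have hx'eq : x' = t • b' := by rw [hx', h1]; simp
    have hval : ∀ j, ℓ' j x' = t * homogenized ℓ' ζ b' j := fun j => by
      have := apply_smul_add_smul ℓ' ζ b' 0 t j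
      rw [h1] at this
      simpa [hx'eq] using this
    have hheight : coneHeight ℓ' ζ b' x' = t :=
      hb'.coneHeight_eq (fun j => (hval j).ge) (hval i).symm
    refine ⟨fun j => by rw [hval]; exact mul_nonneg ht (hb'.pos j).le, ?_⟩
    rw [coneMap, hheight, h1, heq h1]
    simp
  · have hu : 0 < 1 - t * ζ := sub_pos.2 h1
    set u := 1 - t * ζ with hu_def
    set y := u⁻¹ • (x - t • b) with hy
    have hxy : t • b + u • y = x := by
      rw [hy, smul_inv_smul₀ hu.ne', add_sub_cancel]
    have hval : ∀ j, ℓ j x = t * homogenized ℓ ζ b j + u * ℓ j y := fun j => by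
      rw [← apply_smul_add_smul, ← hu_def, hxy]
    have hval' : ∀ j, ℓ' j x' = t * homogenized ℓ' ζ b' j + u * ℓ' j (ψ y) := fun j => by
      rw [← apply_smul_add_smul, ← hu_def, hx']
    have hyi : ℓ i y = 0 := by
      have := hval i
      rw [hi, left_eq_add] at this
      exact (mul_eq_zero.1 this).resolve_left hu.ne'
    have hyj : ∀ j, 0 ≤ ℓ j y := fun j => by
      have h2 := hle j
      rw [hval j, le_add_iff_nonneg_right] at h2
      exact nonneg_of_mul_nonneg_right h2 hu
    have hyj' : ∀ j, 0 ≤ u * ℓ' j (ψ y) := fun j =>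
      mul_nonneg hu.le (hψ.nonneg hyi (hyj j))
    have hheight : coneHeight ℓ' ζ b' x' = t := by
      refine hb'.coneHeight_eq (i := i) (fun j => ?_) ?_
      · rw [hval' j, le_add_iff_nonneg_right]; exact hyj' j
      · rw [hval' i, (hψ.eq_zero_iff hyi i).2 hyi]; simp
    refine ⟨fun j => ?_, ?_⟩
    · rw [hval' j]
      exact add_nonneg (mul_nonneg ht (hb'.pos j).le) (hyj' j)
    · rw [coneMap, hheight, ← hu_def]
      have : x' - t • b' = u • ψ y := by rw [hx', add_sub_cancel_left]
      rw [this, inv_smul_smul₀ hu.ne', hinv i y hyi, hxy]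

theorem coneMap_eq_of_boundary (hb : IsPole ℓ ζ b) {x : F × F} (hx : ∀ i, 0 ≤ ℓ i x) {i : ι}
    (hi : ℓ i x = 0) : coneMap ℓ ζ b b' ψ x = ψ x := by
  have : coneHeight ℓ ζ b x = 0 := hb.coneHeight_eq (i := i) (by simpa using hx) (by simp [hi])
  simp [coneMap, this]

/-- A piecewise linear map `f` on the cell where all `ℓ i` are nonnegative to the corresponding
cell of `ℓ'`, which extends `ψ`. -/
structure IsCellMap (ℓ ℓ' : ι → (F × F) →ᵃ[F] F) (ψ f : F × F → F × F) : Prop where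
  nonneg : ∀ x, (∀ i, 0 ≤ ℓ i x) → ∀ i, 0 ≤ ℓ' i (f x)
  eq_boundary : ∀ x, (∀ i, 0 ≤ ℓ i x) → ∀ i, ℓ i x = 0 → f x = ψ x
  piecewise : ∃ C : ι → Set (F × F), (∀ i, IsPlanePolyhedron (C i)) ∧
    (∀ x, (∃ i, x ∈ C i) ↔ ∀ i, 0 ≤ ℓ i x) ∧ ∀ i, ∃ G, IsPLMap G ∧ Set.EqOn f G (C i)

theorem isCellMap_coneMap (hb : IsPole ℓ ζ b) (hb' : IsPole ℓ' ζ b') (hψ : IsSkeletonMap ℓ ℓ' ψ)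
    (hinv : ∀ i y, ℓ i y = 0 → ψ' (ψ y) = y) : IsCellMap ℓ ℓ' ψ (coneMap ℓ ζ b b' ψ) := by
  refine ⟨fun x hx => (coneMap_spec hb hb' hψ hinv hx).1,
    fun x hx i hi => coneMap_eq_of_boundary hb hx hi, ?_⟩
  set h := homogenized ℓ ζ b with hh
  -- The piece over side `i`: the entry `none` says `0 ≤ ℓ i x`, and `some j` says that the ratio of
  -- index `i` is at most that of `j`. There the height is the affine function `τ`.
  refine ⟨fun i => {x | ∀ j : Option ι,
    0 ≤ j.elim (ℓ i) (fun j => (h j)⁻¹ • ℓ j - (h i)⁻¹ • ℓ i) x},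
    fun i => isPlanePolyhedron_of_fintype _, fun x => ⟨?_, fun hx => ?_⟩, fun i => ?_⟩
  · rintro ⟨i, hi⟩ j
    have h1 : 0 ≤ ℓ i x := hi none
    have h2 : 0 ≤ (h j)⁻¹ * ℓ j x - (h i)⁻¹ * ℓ i x := hi (some j)
    have h3 : 0 ≤ (h j)⁻¹ * ℓ j x :=
      (mul_nonneg (inv_pos.2 (hb.pos i)).le h1).trans (sub_nonneg.1 h2)
    exact nonneg_of_mul_nonneg_right h3 (inv_pos.2 (hb.pos j))
  · obtain ⟨i, hi⟩ := hb.exists_coneHeight_mul_eq x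
    refine ⟨i, ?_⟩
    rintro (_ | j)
    · exact hx i
    · show 0 ≤ (h j)⁻¹ * ℓ j x - (h i)⁻¹ * ℓ i x
      rw [← hi, ← hh, mul_comm (h i)⁻¹, mul_inv_cancel_right₀ (hb.pos i).ne', sub_nonneg,
        le_inv_mul_iff₀ (hb.pos j), mul_comm]
      exact hb.coneHeight_mul_le x j
  · set τ : (F × F) →ᵃ[F] F := (h i)⁻¹ • ℓ i with hτ
    -- With `s = x - τ b` and `z = 1 - ζ τ`, the boundary term is `z • ψ (z⁻¹ • s)`; at the apex
    -- both vanish.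
    obtain ⟨G, hG, hGψ⟩ := hψ.homogenization i
      (AffineMap.id F (F × F) - (LinearMap.toSpanSingleton F (F × F) b).toAffineMap.comp τ)
      (AffineMap.const F (F × F) (1 : F) - ζ • τ)
    refine ⟨_, hG.affine_add ((LinearMap.toSpanSingleton F (F × F) b').toAffineMap.comp τ),
      fun x hx => ?_⟩
    have hτx : τ x * h i = ℓ i x := by
      show (h i)⁻¹ * ℓ i x * h i = ℓ i x
      rw [mul_comm, mul_inv_cancel_left₀ (hb.pos i).ne']
    have hle : ∀ j, τ x * h j ≤ ℓ j x := fun j => by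
      have h2 : 0 ≤ (h j)⁻¹ * ℓ j x - τ x := hx (some j)
      rw [sub_nonneg, le_inv_mul_iff₀ (hb.pos j), mul_comm] at h2
      exact h2
    have hheight : coneHeight ℓ ζ b x = τ x := hb.coneHeight_eq hle hτx
    have hz : (AffineMap.const F (F × F) (1 : F) - ζ • τ) x = 1 - τ x * ζ := by
      simp [mul_comm]
    have hs : (AffineMap.id F (F × F) -
        (LinearMap.toSpanSingleton F (F × F) b).toAffineMap.comp τ) x = x - τ x • b := by
      simp
    have hGx := hGψ x
    rw [hz, hs] at hGx
    have hT : (LinearMap.toSpanSingleton F (F × F) b').toAffineMap.comp τ x = τ x • b' := by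
      simp
    show _ = (LinearMap.toSpanSingleton F (F × F) b').toAffineMap.comp τ x + G x
    rw [hT, coneMap, hheight]
    congr 1
    rcases (hb.le_one x _ hle).eq_or_lt with h1 | h1
    · have h0 : 1 - τ x * ζ = 0 := sub_eq_zero.2 h1.symm
      rw [hGx.2 h0 (sub_eq_zero.2 (hb.eq_of_eq_one x _ hle h1)), h0, zero_smul]
    · have hu : 0 < 1 - τ x * ζ := sub_pos.2 h1
      refine (hGx.1 hu ?_).symm
      have := apply_smul_add_smul ℓ ζ b ((1 - τ x * ζ)⁻¹ • (x - τ x • b)) (τ x) i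
      rw [smul_inv_smul₀ hu.ne', add_sub_cancel, ← hh, hτx, left_eq_add] at this
      exact (mul_eq_zero.1 this).resolve_left hu.ne'

end Height

variable [IsStrictOrderedRing F]

theorem exists_isCellMap [Finite ι] [Nonempty ι] (hℓ : DistinctDirections ℓ)
    (hℓ' : DistinctDirections ℓ') (hψ : IsSkeletonMap ℓ ℓ' ψ) (hψ' : IsSkeletonMap ℓ' ℓ ψ')
    (hinv : ∀ i y, ℓ i y = 0 → ψ' (ψ y) = y) (hinv' : ∀ i y, ℓ' i y = 0 → ψ (ψ' y) = y)
    (hne : ∃ x, ∀ i, 0 < ℓ i x) :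
    ∃ f f', IsCellMap ℓ ℓ' ψ f ∧ IsCellMap ℓ' ℓ ψ' f' ∧
      (∀ x, (∀ i, 0 ≤ ℓ i x) → f' (f x) = x) ∧ (∀ x, (∀ i, 0 ≤ ℓ' i x) → f (f' x) = x) := by
  have := Fintype.ofFinite ι
  obtain ⟨x, hx⟩ := hne
  obtain ⟨ζ, b, b', hb, hb'⟩ := exists_isPole_isPole hψ hψ' hℓ hℓ' hx
  exact ⟨coneMap ℓ ζ b b' ψ, coneMap ℓ' ζ b' b ψ', isCellMap_coneMap hb hb' hψ hinv,
    isCellMap_coneMap hb' hb hψ' hinv', fun x hx => (coneMap_spec hb hb' hψ hinv hx).2,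
    fun x hx => (coneMap_spec hb' hb hψ' hinv' hx).2⟩

end ConeMap

/-! ### Gluing over the cells -/

section Glue

variable {F : Type*} [Field F] {ι : Type*}

/-- The functions `ℓ i` with the signs given by `σ`. -/
def withSigns (ℓ : ι → (F × F) →ᵃ[F] F) (σ : ι → Bool) (i : ι) : (F × F) →ᵃ[F] F :=
  (cond (σ i) 1 (-1) : F) • ℓ i

theorem withSigns_apply (ℓ : ι → (F × F) →ᵃ[F] F) (σ : ι → Bool) (i : ι) (x : F × F) :
    withSigns ℓ σ i x = cond (σ i) 1 (-1) * ℓ i x := rfl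

theorem withSigns_linear_apply (ℓ : ι → (F × F) →ᵃ[F] F) (σ : ι → Bool) (i : ι) (x : F × F) :
    (withSigns ℓ σ i).linear x = cond (σ i) 1 (-1) * (ℓ i).linear x := rfl

variable [LinearOrder F] [IsStrictOrderedRing F]

variable {ℓ ℓ' : ι → (F × F) →ᵃ[F] F} {ψ ψ' : F × F → F × F}

theorem cond_one_neg_one_ne_zero (s : Bool) : (cond s 1 (-1) : F) ≠ 0 := by
  cases s <;> simp

theorem withSigns_eq_zero (σ : ι → Bool) (i : ι) (x : F × F) :
    withSigns ℓ σ i x = 0 ↔ ℓ i x = 0 := by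
  simp [withSigns_apply, cond_one_neg_one_ne_zero]

theorem DistinctDirections.change_signs (h : DistinctDirections ℓ) (σ : ι → Bool) :
    DistinctDirections (withSigns ℓ σ) := by
  have key : ∀ i d, (withSigns ℓ σ i).linear d = 0 ↔ (ℓ i).linear d = 0 := fun i d => by
    simp [withSigns_linear_apply, cond_one_neg_one_ne_zero]
  refine ⟨fun i => ?_, fun i j hij d hi hj => ?_⟩
  · obtain ⟨d, hd⟩ := h.nonconstant i
    exact ⟨d, fun h0 => hd ((key i d).1 h0)⟩
  · exact h.indep i j hij d ((key i d).1 hi) ((key j d).1 hj)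

theorem IsSkeletonMap.change_signs (h : IsSkeletonMap ℓ ℓ' ψ) (σ : ι → Bool) :
    IsSkeletonMap (withSigns ℓ σ) (withSigns ℓ' σ) ψ := by
  refine ⟨fun i j x hx => ?_, fun i d hd hd' => ?_, fun i s z => ?_⟩
  · rw [withSigns_eq_zero] at hx
    rw [withSigns_apply, withSigns_apply, sign_mul, sign_mul, h.sign_eq i j x hx]
  · rw [withSigns_linear_apply, mul_eq_zero, or_iff_right (cond_one_neg_one_ne_zero _)] at hd'
    obtain ⟨d', h1, h2, h3⟩ := h.ray i d hd hd'
    refine ⟨d', h1, by rw [withSigns_linear_apply, h2, mul_zero], fun y hy => h3 y ?_⟩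
    rwa [withSigns_eq_zero] at hy
  · simpa only [withSigns_eq_zero] using h.homogenization i s z

/-- The closed cells with nonempty interior cover the plane. -/
theorem DistinctDirections.exists_cell [Finite ι] (h : DistinctDirections ℓ) (x : F × F) :
    ∃ σ : ι → Bool, (∃ y, ∀ i, 0 < withSigns ℓ σ i y) ∧ ∀ i, 0 ≤ withSigns ℓ σ i x := by
  obtain ⟨e, he⟩ := h.exists_forall_linear_ne_zero
  -- On a line through `x` the side is chosen by the generic direction `e`, so a small step along
  -- `e` enters the open cell.
  have hσ : ∀ i, ∃ s : Bool, 0 < (cond s 1 (-1) : F) * ℓ i x ∨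
      ((cond s 1 (-1) : F) * ℓ i x = 0 ∧ 0 < (cond s 1 (-1) : F) * (ℓ i).linear e) := by
    intro i
    rcases lt_trichotomy (ℓ i x) 0 with h0 | h0 | h0
    · exact ⟨false, Or.inl (by simpa using h0)⟩
    · rcases (he i).lt_or_gt with h1 | h1
      · exact ⟨false, Or.inr (by simpa [h0] using h1)⟩
      · exact ⟨true, Or.inr (by simpa [h0] using h1)⟩
    · exact ⟨true, Or.inl (by simpa using h0)⟩
  choose σ hσ using hσ
  obtain ⟨s, -, hs⟩ := exists_pos_forall_add_mul_pos _ _ hσ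
  refine ⟨σ, ⟨x + s • e, fun i => ?_⟩, fun i => ?_⟩
  · rw [affineMap_add_smul_apply]
    exact hs i
  · rcases hσ i with h1 | h1
    · exact h1.le
    · exact h1.1.ge

theorem exists_eq_zero_of_ne {σ τ : ι → Bool} (hστ : σ ≠ τ) {x : F × F}
    (hσ : ∀ i, 0 ≤ withSigns ℓ σ i x) (hτ : ∀ i, 0 ≤ withSigns ℓ τ i x) : ∃ i, ℓ i x = 0 := by
  obtain ⟨i, hi⟩ := Function.ne_iff.1 hστ
  refine ⟨i, ?_⟩
  have h1 := hσ i
  have h2 := hτ i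
  rw [withSigns_apply] at h1 h2
  cases h3 : σ i <;> cases h4 : τ i <;> simp_all <;> exact le_antisymm ‹_› ‹_›

/-- A point of two different closed cells lies on a line, where both maps equal `ψ`; the choice of
cell is therefore immaterial. -/
theorem exists_glue_cellMaps [Finite ι] {Γ : Set (ι → Bool)}
    (hcov : ∀ x, ∃ σ ∈ Γ, ∀ i, 0 ≤ withSigns ℓ σ i x) (f : Γ → F × F → F × F)
    (hf : ∀ σ : Γ, IsCellMap (withSigns ℓ σ) (withSigns ℓ' σ) ψ (f σ)) :
    ∃ g : F × F → F × F, IsPiecewiseLinearMap g ∧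
      ∀ σ : Γ, ∀ x, (∀ i, 0 ≤ withSigns ℓ σ i x) → g x = f σ x := by
  choose c hc hcx using hcov
  have hg : ∀ σ : Γ, ∀ x, (∀ i, 0 ≤ withSigns ℓ σ i x) → f ⟨c x, hc x⟩ x = f σ x := by
    intro σ x hx
    by_cases hσ : c x = σ
    · congr 1
      exact Subtype.ext hσ
    · obtain ⟨i, hi⟩ := exists_eq_zero_of_ne hσ (hcx x) hx
      rw [(hf _).eq_boundary x (hcx x) i ((withSigns_eq_zero _ _ _).2 hi),
        (hf _).eq_boundary x hx i ((withSigns_eq_zero _ _ _).2 hi)]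
  refine ⟨fun x => f ⟨c x, hc x⟩ x, ?_, hg⟩
  choose C hC hCcov G hG using fun σ => (hf σ).piecewise
  refine IsPLMap.of_cover (fun p : Γ × ι => C p.1 p.2) (fun p => hC _ _) (fun x => ?_)
    fun p => ⟨G p.1 p.2, (hG _ _).1, fun x hx => ?_⟩
  · obtain ⟨i, hi⟩ := (hCcov ⟨c x, hc x⟩ x).2 (hcx x)
    exact ⟨(⟨c x, hc x⟩, i), hi⟩
  · show f ⟨c x, hc x⟩ x = _
    rw [hg p.1 x ((hCcov _ _).1 ⟨p.2, hx⟩)]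
    exact (hG _ _).2 hx

/-- A piecewise linear isomorphism between the unions of the lines of two arrangements that is
compatible with sides extends to a piecewise linear automorphism of the plane. -/
theorem exists_isPiecewiseLinearAut_of_skeleton [Finite ι] [Nonempty ι]
    (hℓ : DistinctDirections ℓ) (hℓ' : DistinctDirections ℓ') (hψ : IsSkeletonMap ℓ ℓ' ψ)
    (hψ' : IsSkeletonMap ℓ' ℓ ψ') (hinv : ∀ i y, ℓ i y = 0 → ψ' (ψ y) = y)
    (hinv' : ∀ i y, ℓ' i y = 0 → ψ (ψ' y) = y) :
    ∃ f : (F × F) ≃ (F × F), IsPiecewiseLinearAut f ∧ ∀ i x, ℓ i x = 0 → f x = ψ x := by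
  set Γ : Set (ι → Bool) := {σ | ∃ y, ∀ i, 0 < withSigns ℓ σ i y}
  have hcov : ∀ x, ∃ σ ∈ Γ, ∀ i, 0 ≤ withSigns ℓ σ i x := fun x => hℓ.exists_cell x
  -- `ψ'` carries nonempty cells of `ℓ'` back to nonempty cells of `ℓ`, so `Γ` serves both sides.
  have hcov' : ∀ x, ∃ σ ∈ Γ, ∀ i, 0 ≤ withSigns ℓ' σ i x := fun x => by
    obtain ⟨σ, ⟨y, hy⟩, hx⟩ := hℓ'.exists_cell x
    exact ⟨σ, (hψ'.change_signs σ).exists_forall_pos (hℓ'.change_signs σ) (hℓ.change_signs σ) hy, hx⟩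
  choose f f' hf hf' hl hr using fun σ : Γ =>
    exists_isCellMap (hℓ.change_signs σ) (hℓ'.change_signs σ) (hψ.change_signs σ) (hψ'.change_signs σ)
      (fun i y hy => hinv i y ((withSigns_eq_zero _ _ _).1 hy))
      (fun i y hy => hinv' i y ((withSigns_eq_zero _ _ _).1 hy)) σ.2
  obtain ⟨g, hg, hgf⟩ := exists_glue_cellMaps hcov f hf
  obtain ⟨g', hg', hgf'⟩ := exists_glue_cellMaps hcov' f' hf'
  refine ⟨⟨g, g', fun x => ?_, fun x => ?_⟩, ⟨hg, hg'⟩, fun i x hi => ?_⟩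
  · obtain ⟨σ, hσ, hx⟩ := hcov x
    rw [hgf ⟨σ, hσ⟩ x hx, hgf' ⟨σ, hσ⟩ _ ((hf ⟨σ, hσ⟩).nonneg x hx), hl ⟨σ, hσ⟩ x hx]
  · obtain ⟨σ, hσ, hx⟩ := hcov' x
    rw [hgf' ⟨σ, hσ⟩ x hx, hgf ⟨σ, hσ⟩ _ ((hf' ⟨σ, hσ⟩).nonneg x hx), hr ⟨σ, hσ⟩ x hx]
  · obtain ⟨σ, hσ, hx⟩ := hcov x
    exact (hgf ⟨σ, hσ⟩ x hx).trans
      ((hf ⟨σ, hσ⟩).eq_boundary x hx i ((withSigns_eq_zero _ _ _).2 hi))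

end Glue

/-! ### Lines in coordinates, and their intersections -/

section LineCoordinates

variable {F : Type*} [Field F]

/-- The linear form with kernel spanned by `w`. -/
def crossForm (w : F × F) : (F × F) →ₗ[F] F :=
  w.1 • LinearMap.snd F F F - w.2 • LinearMap.fst F F F

theorem crossForm_apply (w d : F × F) : crossForm w d = w.1 * d.2 - w.2 * d.1 := rfl

theorem crossForm_self (w : F × F) : crossForm w w = 0 := by
  rw [crossForm_apply]; ring

theorem exists_smul_of_crossForm_eq_zero {w d : F × F} (hw : w ≠ 0) (h : crossForm w d = 0) :
    ∃ c : F, d = c • w := by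
  obtain ⟨a, b⟩ := w
  obtain ⟨x, y⟩ := d
  rw [crossForm_apply] at h
  simp only at h
  by_cases ha : a = 0
  · subst ha
    have hb : b ≠ 0 := fun hb => hw (by rw [hb]; rfl)
    refine ⟨y / b, ?_⟩
    have hx : x = 0 := by simpa [hb] using h
    ext <;> simp [hx, hb]
  · refine ⟨x / a, ?_⟩
    ext
    · simp [ha]
    · simp only [Prod.smul_mk, smul_eq_mul]
      field_simp
      linear_combination h

/-- An affine function whose zero set is the line through `v` with direction `w`. -/
def lineForm (v w : F × F) : (F × F) →ᵃ[F] F :=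
  (crossForm w).toAffineMap - AffineMap.const F (F × F) (crossForm w v)

theorem lineForm_apply (v w x : F × F) : lineForm v w x = crossForm w (x - v) := by
  rw [map_sub]; rfl

theorem lineForm_linear (v w : F × F) : (lineForm v w).linear = crossForm w := by
  simp [lineForm]

theorem lineForm_eq_zero_iff {v w : F × F} (hw : w ≠ 0) (x : F × F) :
    lineForm v w x = 0 ↔ ∃ t : F, x = v + t • w := by
  rw [lineForm_apply]
  constructor
  · intro h
    obtain ⟨c, hc⟩ := exists_smul_of_crossForm_eq_zero hw h
    exact ⟨c, by rw [← hc, add_sub_cancel]⟩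
  · rintro ⟨t, rfl⟩
    rw [add_sub_cancel_left, map_smul, crossForm_self, smul_zero]

theorem exists_linear_eq_one {w : F × F} (hw : w ≠ 0) : ∃ T : (F × F) →ₗ[F] F, T w = 1 := by
  by_cases h : w.1 = 0
  · have h' : w.2 ≠ 0 := fun h' => hw (Prod.ext h h')
    exact ⟨w.2⁻¹ • LinearMap.snd F F F, by simp [h']⟩
  · exact ⟨w.1⁻¹ • LinearMap.fst F F F, by simp [h]⟩

variable {L M : AffineSubspace F (F × F)} {v w v' w' : F × F}

theorem IsLineCoordinate.mem_iff (h : IsLineCoordinate L v w) (x : F × F) :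
    x ∈ L ↔ ∃ t : F, x = v + t • w := by
  rw [← SetLike.mem_coe, h.2]
  simp [eq_comm]

theorem IsLineCoordinate.add_smul_mem (h : IsLineCoordinate L v w) (t : F) : v + t • w ∈ L :=
  (h.mem_iff _).2 ⟨t, rfl⟩

theorem IsLineCoordinate.injective (h : IsLineCoordinate L v w) {s t : F}
    (hst : v + s • w = v + t • w) : s = t :=
  smul_left_injective F h.1 (add_left_cancel hst)

theorem IsPlaneLine.exists_isLineCoordinate (hL : IsPlaneLine L) :
    ∃ v w, IsLineCoordinate L v w := by
  rw [IsPlaneLine] at hL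
  obtain ⟨w, hw, hspan⟩ := finrank_eq_one_iff'.1 hL
  have hne : (L : Set (F × F)).Nonempty := by
    rw [AffineSubspace.nonempty_iff_ne_bot]
    intro hbot
    rw [hbot, AffineSubspace.direction_bot, finrank_bot] at hL
    exact zero_ne_one hL
  obtain ⟨v, hv⟩ := hne
  refine ⟨v, w, fun h0 => hw (Subtype.ext h0), Set.ext fun x => ⟨fun hx => ?_, ?_⟩⟩
  · obtain ⟨c, hc⟩ := hspan ⟨x -ᵥ v, AffineSubspace.vsub_mem_direction hx hv⟩
    have hc' : c • (w : F × F) = x - v := congrArg Subtype.val hc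
    exact ⟨c, by simp [hc']⟩
  · rintro ⟨t, rfl⟩
    have := AffineSubspace.vadd_mem_of_mem_direction (L.direction.smul_mem t w.2) hv
    rwa [vadd_eq_add, add_comm] at this

theorem IsLineCoordinate.parallel_of_smul (hL : IsLineCoordinate L v w)
    (hM : IsLineCoordinate M v' w') {c : F} (hc : w' = c • w) : L.Parallel M := by
  have hc0 : c ≠ 0 := fun h => hM.1 (by rw [hc, h, zero_smul])
  refine ⟨v' - v, SetLike.ext fun x => ?_⟩
  rw [hM.mem_iff, AffineSubspace.mem_map]
  constructor
  · rintro ⟨t, rfl⟩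
    refine ⟨v + (t * c) • w, hL.add_smul_mem _, ?_⟩
    rw [hc, mul_smul]
    simp only [AffineEquiv.coe_toAffineMap, AffineEquiv.constVAdd_apply, vadd_eq_add]
    abel
  · rintro ⟨y, hy, rfl⟩
    obtain ⟨t, rfl⟩ := (hL.mem_iff y).1 hy
    refine ⟨t * c⁻¹, ?_⟩
    rw [hc, mul_smul, inv_smul_smul₀ hc0]
    simp only [AffineEquiv.coe_toAffineMap, AffineEquiv.constVAdd_apply, vadd_eq_add]
    abel

theorem IsLineCoordinate.crossForm_ne_zero (hL : IsLineCoordinate L v w)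
    (hM : IsLineCoordinate M v' w') (h : ¬ L.Parallel M) : crossForm w w' ≠ 0 := fun h0 => by
  obtain ⟨c, hc⟩ := exists_smul_of_crossForm_eq_zero hL.1 h0
  exact h (hL.parallel_of_smul hM hc)

theorem lineForm_add_smul (x d : F × F) (t : F) :
    lineForm v w (x + t • d) = lineForm v w x + t * crossForm w d := by
  rw [affineMap_add_smul_apply, lineForm_linear]

variable {A : Finset (AffineSubspace F (F × F))}

theorem IsLineArrangement.exists_mem_inter (hA : IsLineArrangement A) (hL : L ∈ A) (hM : M ∈ A)
    (hLM : L ≠ M) : ∃ p, p ∈ L ∧ p ∈ M := by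
  obtain ⟨v, w, hvw⟩ := (hA.isLine L hL).exists_isLineCoordinate
  obtain ⟨v', w', hvw'⟩ := (hA.isLine M hM).exists_isLineCoordinate
  have h := hvw.crossForm_ne_zero hvw' (hA.not_parallel L hL M hM hLM)
  refine ⟨v' + (-(lineForm v w v') / crossForm w w') • w', ?_, hvw'.add_smul_mem _⟩
  rw [hvw.mem_iff, ← lineForm_eq_zero_iff hvw.1, lineForm_add_smul, div_mul_cancel₀ _ h,
    add_neg_cancel]

theorem IsLineArrangement.eq_of_mem_inter (hA : IsLineArrangement A) (hL : L ∈ A) (hM : M ∈ A)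
    (hLM : L ≠ M) {p q : F × F} (hpL : p ∈ L) (hpM : p ∈ M) (hqL : q ∈ L) (hqM : q ∈ M) :
    p = q := by
  obtain ⟨v, w, hvw⟩ := (hA.isLine L hL).exists_isLineCoordinate
  obtain ⟨v', w', hvw'⟩ := (hA.isLine M hM).exists_isLineCoordinate
  have h := hvw.crossForm_ne_zero hvw' (hA.not_parallel L hL M hM hLM)
  obtain ⟨s, rfl⟩ := (hvw'.mem_iff p).1 hpM
  obtain ⟨t, rfl⟩ := (hvw'.mem_iff q).1 hqM
  rw [hvw.mem_iff, ← lineForm_eq_zero_iff hvw.1, lineForm_add_smul] at hpL hqL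
  have : s * crossForm w w' = t * crossForm w w' := by linear_combination hpL - hqL
  rw [mul_right_cancel₀ h this]

theorem exists_mem_ne_of_mem_intersectionPoints {p : F × F} (hp : p ∈ intersectionPoints A)
    (L : AffineSubspace F (F × F)) : ∃ M ∈ A, M ≠ L ∧ p ∈ M := by
  obtain ⟨M, hM, N, hN, hMN, hpM, hpN⟩ := hp
  by_cases h : M = L
  · exact ⟨N, hN, fun h' => hMN (h.trans h'.symm), hpN⟩
  · exact ⟨M, hM, h, hpM⟩

theorem IsLineArrangement.finite_intersectionPoints (hA : IsLineArrangement A) :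
    (intersectionPoints A).Finite := by
  refine ((A ×ˢ A).finite_toSet.biUnion (t := fun q => {p | q.1 ≠ q.2 ∧ p ∈ q.1 ∧ p ∈ q.2})
    fun q hq => Set.Subsingleton.finite ?_).subset ?_
  · rintro p ⟨h, h1, h2⟩ p' ⟨-, h3, h4⟩
    rw [Finset.mem_coe, Finset.mem_product] at hq
    exact hA.eq_of_mem_inter hq.1 hq.2 h h1 h2 h3 h4
  · rintro p ⟨L, hL, M, hM, h⟩
    exact Set.mem_biUnion (x := (L, M)) (by simp [hL, hM]) h

end LineCoordinates

/-! ### The bijection of lines induced by a collineation isomorphism -/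

section LineBijection

variable {F : Type*} [Field F] {A B : Finset (AffineSubspace F (F × F))} {φ : F × F → F × F}

/-- Once the images of two points `P`, `Q` of `L` share a line `N`, collinearity puts all the others
on `N`. A third point on `L` supplies `N` when a fourth line exists. -/
theorem IsLineArrangementCollineationIso.exists_line_of_three_le
    (hφ : IsLineArrangementCollineationIso A B φ) (hA : IsLineArrangement A)
    (hB : IsLineArrangement B) (hcard : A.card = B.card) (h3 : 3 ≤ A.card)
    {L : AffineSubspace F (F × F)} (hL : L ∈ A) :
    ∃ N ∈ B, ∀ p ∈ intersectionPoints A, p ∈ L → φ p ∈ N := by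
  classical
  obtain ⟨M, K, hM, hK, hMK⟩ : ∃ M K, M ∈ A.erase L ∧ K ∈ A.erase L ∧ M ≠ K := by
    have : 1 < (A.erase L).card := by rw [Finset.card_erase_of_mem hL]; omega
    obtain ⟨M, hM, K, hK, h⟩ := Finset.one_lt_card.1 this
    exact ⟨M, K, hM, hK, h⟩
  obtain ⟨hML, hM⟩ := Finset.mem_erase.1 hM
  obtain ⟨hKL, hK⟩ := Finset.mem_erase.1 hK
  obtain ⟨P, hPL, hPM⟩ := hA.exists_mem_inter hL hM hML.symm
  obtain ⟨Q, hQL, hQK⟩ := hA.exists_mem_inter hL hK hKL.symm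
  have hPA : P ∈ intersectionPoints A := ⟨L, hL, M, hM, hML.symm, hPL, hPM⟩
  have hQA : Q ∈ intersectionPoints A := ⟨L, hL, K, hK, hKL.symm, hQL, hQK⟩
  have hPQ : P ≠ Q := by
    rintro rfl
    exact hA.not_concurrent L hL M hM K hK hML.symm hKL.symm hMK ⟨P, hPL, hPM, hQK⟩
  have hφPQ : φ P ≠ φ Q := fun h => hPQ (hφ.bijOn.injOn hPA hQA h)
  suffices H : ∃ N ∈ B, φ P ∈ N ∧ φ Q ∈ N by
    obtain ⟨N, hN, hPN, hQN⟩ := H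
    refine ⟨N, hN, fun X hX hXL => ?_⟩
    by_cases hXP : X = P
    · rwa [hXP]
    by_cases hXQ : X = Q
    · rwa [hXQ]
    obtain ⟨N', hN', hPN', hQN', hXN'⟩ := hφ.collinear P hPA Q hQA X hX hPQ (Ne.symm hXP)
      (Ne.symm hXQ) ⟨L, hL, hPL, hQL, hXL⟩
    by_cases hNN' : N = N'
    · rwa [hNN']
    · exact absurd (hB.eq_of_mem_inter hN hN' hNN' hPN hPN' hQN hQN') hφPQ
  by_cases hX : ∃ X ∈ A, X ≠ L ∧ X ≠ M ∧ X ≠ K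
  · obtain ⟨J, hJ, hJL, hJM, hJK⟩ := hX
    obtain ⟨X, hXL, hXJ⟩ := hA.exists_mem_inter hL hJ hJL.symm
    have hXP : P ≠ X := by
      rintro rfl
      exact hA.not_concurrent L hL M hM J hJ hML.symm hJL.symm hJM.symm ⟨P, hPL, hPM, hXJ⟩
    have hXQ : Q ≠ X := by
      rintro rfl
      exact hA.not_concurrent L hL K hK J hJ hKL.symm hJL.symm hJK.symm ⟨Q, hQL, hQK, hXJ⟩
    obtain ⟨N, hN, hPN, hQN, -⟩ := hφ.collinear P hPA Q hQA X
      ⟨L, hL, J, hJ, hJL.symm, hXL, hXJ⟩ hPQ hXP hXQ ⟨L, hL, hPL, hQL, hXL⟩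
    exact ⟨N, hN, hPN, hQN⟩
  -- With three lines, images on no common line would need four distinct lines of `B`, two through
  -- each.
  · have hsub : A ⊆ {L, M, K} := fun X hXA => by
      by_contra hX'
      simp only [Finset.mem_insert, Finset.mem_singleton, not_or] at hX'
      exact hX ⟨X, hXA, hX'⟩
    have hB3 : B.card ≤ 3 := by
      rw [← hcard]
      exact (Finset.card_le_card hsub).trans Finset.card_le_three
    obtain ⟨N₁, hN₁, N₂, hN₂, h12, hP1, hP2⟩ := hφ.bijOn.mapsTo hPA
    obtain ⟨N₃, hN₃, N₄, hN₄, h34, hQ3, hQ4⟩ := hφ.bijOn.mapsTo hQA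
    by_contra hcon
    push Not at hcon
    have hne : ∀ N ∈ B, ∀ N' ∈ B, φ P ∈ N → φ Q ∈ N' → N ≠ N' := by
      rintro N hN _ - hP hQ rfl
      exact hcon N hN hP hQ
    have hcard4 : ({N₁, N₂, N₃, N₄} : Finset (AffineSubspace F (F × F))).card = 4 := by
      rw [Finset.card_insert_of_notMem, Finset.card_insert_of_notMem,
        Finset.card_pair h34]
      · simp [hne N₂ hN₂ N₃ hN₃ hP2 hQ3, hne N₂ hN₂ N₄ hN₄ hP2 hQ4]
      · simp [h12, hne N₁ hN₁ N₃ hN₃ hP1 hQ3, hne N₁ hN₁ N₄ hN₄ hP1 hQ4]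
    have : ({N₁, N₂, N₃, N₄} : Finset (AffineSubspace F (F × F))) ⊆ B := by
      simp [Finset.insert_subset_iff, hN₁, hN₂, hN₃, hN₄]
    have := Finset.card_le_card this
    omega

/-- The points of `L` are as many as the other lines of `B`, so their images exhaust the crossings
on `N`. A point of `L'` mapped to `N` must then lie on `L`; taken on a third line `K`, it makes
three lines concurrent. -/
theorem IsLineArrangementCollineationIso.line_injective_of_three_le
    (hφ : IsLineArrangementCollineationIso A B φ) (hA : IsLineArrangement A)
    (hB : IsLineArrangement B) (hcard : A.card = B.card) (h3 : 3 ≤ A.card)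
    {L L' N : AffineSubspace F (F × F)} (hL : L ∈ A) (hL' : L' ∈ A) (hN : N ∈ B)
    (hLN : ∀ p ∈ intersectionPoints A, p ∈ L → φ p ∈ N)
    (hL'N : ∀ p ∈ intersectionPoints A, p ∈ L' → φ p ∈ N) : L = L' := by
  classical
  by_contra hLL'
  have hpt : ∀ M ∈ A.erase L, ∃ p N', p ∈ L ∧ p ∈ M ∧ p ∈ intersectionPoints A ∧
      N' ∈ B.erase N ∧ φ p ∈ N' := fun M hM => by
    obtain ⟨hML, hM⟩ := Finset.mem_erase.1 hM
    obtain ⟨p, hpL, hpM⟩ := hA.exists_mem_inter hL hM hML.symm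
    have hp : p ∈ intersectionPoints A := ⟨L, hL, M, hM, hML.symm, hpL, hpM⟩
    obtain ⟨N', hN', hne, hpN'⟩ :=
      exists_mem_ne_of_mem_intersectionPoints (hφ.bijOn.mapsTo hp) N
    exact ⟨p, N', hpL, hpM, hp, Finset.mem_erase.2 ⟨hne, hN'⟩, hpN'⟩
  choose! p h hpL hpM hpA hhB hph using hpt
  have hinj : Set.InjOn h (A.erase L : Finset _) := by
    intro M hM M' hM' hMM'
    by_contra hne
    obtain ⟨hML, hMA⟩ := Finset.mem_erase.1 hM
    obtain ⟨hM'L, hM'A⟩ := Finset.mem_erase.1 hM'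
    obtain ⟨hhN, hhB'⟩ := Finset.mem_erase.1 (hhB M hM)
    have h1 : φ (p M) = φ (p M') := hB.eq_of_mem_inter hN hhB' hhN.symm
      (hLN _ (hpA M hM) (hpL M hM)) (hph M hM) (hLN _ (hpA M' hM') (hpL M' hM'))
      (hMM' ▸ hph M' hM')
    have h2 : p M = p M' := hφ.bijOn.injOn (hpA M hM) (hpA M' hM') h1
    exact hA.not_concurrent L hL M hMA M' hM'A (Ne.symm hML) (Ne.symm hM'L) hne
      ⟨p M, hpL M hM, hpM M hM, h2 ▸ hpM M' hM'⟩
  obtain ⟨K, hK⟩ : ((A.erase L).erase L').Nonempty := by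
    rw [← Finset.card_pos, Finset.card_erase_of_mem (Finset.mem_erase.2 ⟨Ne.symm hLL', hL'⟩),
      Finset.card_erase_of_mem hL]
    omega
  obtain ⟨hKL', hK⟩ := Finset.mem_erase.1 hK
  obtain ⟨hKL, hK⟩ := Finset.mem_erase.1 hK
  obtain ⟨X, hXL', hXK⟩ := hA.exists_mem_inter hL' hK hKL'.symm
  have hX : X ∈ intersectionPoints A := ⟨L', hL', K, hK, hKL'.symm, hXL', hXK⟩
  obtain ⟨N', hN', hne, hXN'⟩ := exists_mem_ne_of_mem_intersectionPoints (hφ.bijOn.mapsTo hX) N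
  obtain ⟨M, hM, hMN'⟩ := Finset.surj_on_of_inj_on_of_card_le (s := A.erase L) (t := B.erase N)
    (fun M _ => h M) (fun M hM => hhB M hM) (fun M M' hM hM' hMM' => hinj hM hM' hMM')
    (by rw [Finset.card_erase_of_mem hL, Finset.card_erase_of_mem hN, hcard]) N'
    (Finset.mem_erase.2 ⟨hne, hN'⟩)
  have h1 : φ X = φ (p M) := hB.eq_of_mem_inter hN hN' hne.symm (hL'N X hX hXL') hXN'
    (hLN _ (hpA M hM) (hpL M hM)) (hMN' ▸ hph M hM)
  have h2 : X = p M := hφ.bijOn.injOn hX (hpA M hM) h1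
  exact hA.not_concurrent L hL L' hL' K hK hLL' hKL.symm hKL'.symm
    ⟨X, h2 ▸ hpL M hM, hXL', hXK⟩

/-- A collineation isomorphism is induced by a bijection between the lines. -/
theorem IsLineArrangementCollineationIso.exists_line_equiv
    (hφ : IsLineArrangementCollineationIso A B φ) (hA : IsLineArrangement A)
    (hB : IsLineArrangement B) (hcard : A.card = B.card) :
    ∃ e : A ≃ B, ∀ L : A, ∀ p ∈ intersectionPoints A,
      p ∈ (L : AffineSubspace F (F × F)) → φ p ∈ (e L : AffineSubspace F (F × F)) := by
  classical
  by_cases h3 : 3 ≤ A.card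
  · choose N hN hφN using fun L : A => hφ.exists_line_of_three_le hA hB hcard h3 L.2
    have hinj : Function.Injective fun L : A => (⟨N L, hN L⟩ : B) := fun L L' h => by
      have h' : N L = N L' := congrArg Subtype.val h
      exact Subtype.ext (hφ.line_injective_of_three_le hA hB hcard h3 L.2 L'.2 (hN L) (hφN L)
        (h' ▸ hφN L'))
    exact ⟨Equiv.ofBijective _ ((Fintype.bijective_iff_injective_and_card _).2
      ⟨hinj, by simpa using hcard⟩), hφN⟩
  -- With at most two lines, a crossing in `B` lies on every line of `B`.
  · refine ⟨Finset.equivOfCardEq hcard, fun L p hp _ => ?_⟩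
    obtain ⟨N₁, hN₁, N₂, hN₂, h12, h1, h2⟩ := hφ.bijOn.mapsTo hp
    set N := Finset.equivOfCardEq hcard L
    by_cases hN1 : (N : AffineSubspace F (F × F)) = N₁
    · rwa [hN1]
    by_cases hN2 : (N : AffineSubspace F (F × F)) = N₂
    · rwa [hN2]
    have := Finset.two_lt_card_iff.2 ⟨_, _, _, N.2, hN₁, hN₂, hN1, hN2, h12⟩
    omega

end LineBijection

/-! ### Skeleton maps from order isomorphisms -/

section Skeleton

variable {F : Type*} [Field F] {ι : Type*}

theorem exists_map_on_lines (v w : ι → F × F) (u : ι → F → F × F)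
    (h : ∀ i j s t, v i + s • w i = v j + t • w j → u i s = u j t) :
    ∃ ψ : F × F → F × F, ∀ i t, ψ (v i + t • w i) = u i t := by
  have : ∀ x, ∃ y, ∀ i, ∀ t : F, x = v i + t • w i → y = u i t := fun x => by
    by_cases hx : ∃ i, ∃ t : F, x = v i + t • w i
    · obtain ⟨i, t, rfl⟩ := hx
      exact ⟨u i t, fun j s hs => h i j t s hs⟩
    · exact ⟨0, fun i t ht => absurd ⟨i, t, ht⟩ hx⟩
  choose ψ hψ using this
  exact ⟨ψ, fun i t => hψ _ i t rfl⟩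

variable [LinearOrder F] [IsStrictOrderedRing F]

/-- Maps between lines given by order isomorphisms of the coordinates fit together to a skeleton
map. -/
theorem isSkeletonMap_of_orderIso {ℓ ℓ' : ι → (F × F) →ᵃ[F] F} {ψ : F × F → F × F}
    {v w v' w' : ι → F × F} (hw : ∀ i, w i ≠ 0) (hw' : ∀ i, w' i ≠ 0) (g : ι → F ≃o F)
    (hg : ∀ i, IsHingeSum (g i)) (hψ : ∀ i t, ψ (v i + t • w i) = v' i + g i t • w' i)
    (hℓ : ∀ i x, ℓ i x = 0 → ∃ t : F, x = v i + t • w i)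
    (hlin : ∀ i d, (ℓ i).linear d = 0 → ∃ c : F, d = c • w i)
    (hlin' : ∀ i, (ℓ' i).linear (w' i) = 0)
    (hsign : ∀ i j t, SignType.sign (ℓ' j (v' i + g i t • w' i)) =
      SignType.sign (ℓ j (v i + t • w i))) : IsSkeletonMap ℓ ℓ' ψ := by
  refine ⟨fun i j x hx => ?_, fun i d hd hd' => ?_, fun i s z => ?_⟩
  · obtain ⟨t, rfl⟩ := hℓ i x hx
    rw [hψ, hsign]
  · obtain ⟨c, rfl⟩ := hlin i d hd'
    have hc : c ≠ 0 := fun h => hd (by rw [h, zero_smul])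
    -- The sign of `c` tells whether `d` runs with or against `w i`; the image ray runs likewise
    -- along `w' i`, as `g i` is increasing and onto.
    rcases hc.lt_or_gt with hc | hc
    · refine ⟨-w' i, neg_ne_zero.2 (hw' i), by rw [map_neg, hlin', neg_zero],
        fun y hy s' hs' => ?_⟩
      obtain ⟨t, rfl⟩ := hℓ i y hy
      refine ⟨((g i).symm (g i t - s') - t) / c, ?_, div_nonneg_of_nonpos ?_ hc.le⟩
      · rw [smul_smul, div_mul_cancel₀ _ hc.ne, add_assoc, ← add_smul, add_sub_cancel, hψ, hψ,
          OrderIso.apply_symm_apply]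
        module
      · rw [sub_nonpos, OrderIso.symm_apply_le]
        linarith
    · refine ⟨w' i, hw' i, hlin' i, fun y hy s' hs' => ?_⟩
      obtain ⟨t, rfl⟩ := hℓ i y hy
      refine ⟨((g i).symm (g i t + s') - t) / c, ?_, div_nonneg ?_ hc.le⟩
      · rw [smul_smul, div_mul_cancel₀ _ hc.ne', add_assoc, ← add_smul, add_sub_cancel, hψ, hψ,
          OrderIso.apply_symm_apply]
        module
      · rw [sub_nonneg, OrderIso.le_symm_apply]
        linarith
  -- `T` reads off the line coordinate: `T s - T (v i) z` is `z` times the coordinate of `z⁻¹ • s`.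
  · obtain ⟨T, hT⟩ := exists_linear_eq_one (hw i)
    obtain ⟨G, hG, hGg⟩ := (hg i).exists_homogenization (T.toAffineMap.comp s - T (v i) • z) z
    have hs : ∀ x, (T.toAffineMap.comp s - T (v i) • z) x = T (s x) - T (v i) * z x :=
      fun x => rfl
    refine ⟨_, (hG.linear_comp (LinearMap.toSpanSingleton F (F × F) (w' i))).affine_add
      ((LinearMap.toSpanSingleton F (F × F) (v' i)).toAffineMap.comp z), fun x =>
      ⟨fun hz hx => ?_, fun hz hx => ?_⟩⟩
    · obtain ⟨t, ht⟩ := hℓ i _ hx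
      have hsx : s x = z x • (v i + t • w i) := by rw [← ht, smul_inv_smul₀ hz.ne']
      have hparam : (T.toAffineMap.comp s - T (v i) • z) x / z x = t := by
        rw [hs, hsx, map_smul, map_add, map_smul, hT, smul_eq_mul, smul_eq_mul]
        field_simp
        ring
      have hGx := (hGg x).1 hz
      rw [hparam] at hGx
      rw [ht, hψ]
      simp only [AffineMap.coe_comp, LinearMap.coe_toAffineMap, Function.comp_apply,
        LinearMap.toSpanSingleton_apply, hGx]
      module
    · have hGx := (hGg x).2 hz (by rw [hs, hx, hz]; simp)
      simp [hGx, hz]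

theorem sign_sub_eq_of_orderIso (g : F ≃o F) (s t : F) :
    SignType.sign (g s - g t) = SignType.sign (s - t) := by
  rcases lt_trichotomy s t with h | rfl | h
  · rw [sign_neg (sub_neg.2 h), sign_neg (sub_neg.2 (g.lt_iff_lt.2 h))]
  · simp
  · rw [sign_pos (sub_pos.2 h), sign_pos (sub_pos.2 (g.lt_iff_lt.2 h))]

/-- On a transversal line, the two sides of a line correspond to the two sides of its image. -/
theorem exists_sign_factor {v w v' w' a d a' d' : F × F} (hc : crossForm w d ≠ 0)
    (hc' : crossForm w' d' ≠ 0) (g : F ≃o F) {t₀ : F} (h : lineForm v w (a + t₀ • d) = 0)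
    (h' : lineForm v' w' (a' + g t₀ • d') = 0) :
    ∃ k : F, k ≠ 0 ∧ ∀ t, SignType.sign (k * lineForm v' w' (a' + g t • d')) =
      SignType.sign (lineForm v w (a + t • d)) := by
  -- Both forms are a slope times a difference of coordinates; this `k` carries over the first slope
  -- and squares the second.
  refine ⟨crossForm w d * crossForm w' d', mul_ne_zero hc hc', fun t => ?_⟩
  have h1 : lineForm v w (a + t • d) = (t - t₀) * crossForm w d := by
    rw [lineForm_add_smul] at h ⊢
    linear_combination h
  have h2 : crossForm w d * crossForm w' d' * lineForm v' w' (a' + g t • d') =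
      (g t - g t₀) * crossForm w d * (crossForm w' d' * crossForm w' d') := by
    rw [lineForm_add_smul] at h' ⊢
    linear_combination crossForm w d * crossForm w' d' * h'
  rw [h1, h2, sign_mul, sign_pos (mul_self_pos.2 hc'), mul_one, sign_mul,
    sign_sub_eq_of_orderIso, ← sign_mul]

end Skeleton

/-! ### Compatibility of sides, and the theorem -/

section Main

variable {F : Type*} [Field F] [LinearOrder F] [IsStrictOrderedRing F]
  {A B : Finset (AffineSubspace F (F × F))}

theorem PreservesIntersectionOrder.exists_orderIso {φ : F × F → F × F}
    (hord : PreservesIntersectionOrder A B φ) (hA : IsLineArrangement A)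
    {L M : AffineSubspace F (F × F)} (hL : L ∈ A) (hM : M ∈ B)
    (hLM : ∀ p ∈ intersectionPoints A, p ∈ L → φ p ∈ M) :
    ∃ v w v' w', IsLineCoordinate L v w ∧ IsLineCoordinate M v' w' ∧ ∃ g : F ≃o F,
      IsHingeSum g ∧ IsHingeSum g.symm ∧
      ∀ t : F, v + t • w ∈ intersectionPoints A → φ (v + t • w) = v' + g t • w' := by
  obtain ⟨v, w, v', w', hvw, hvw', h⟩ := hord L hL M hM hLM
  have hex : ∀ t : F, ∃ t' : F, v + t • w ∈ intersectionPoints A →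
      φ (v + t • w) = v' + t' • w' := fun t => by
    by_cases ht : v + t • w ∈ intersectionPoints A
    · obtain ⟨t', ht'⟩ := (hvw'.mem_iff _).1 (hLM _ ht (hvw.add_smul_mem t))
      exact ⟨t', fun _ => ht'⟩
    · exact ⟨0, fun ht' => absurd ht' ht⟩
  choose u hu using hex
  have hfin : {t : F | v + t • w ∈ intersectionPoints A}.Finite :=
    hA.finite_intersectionPoints.preimage fun s _ t _ hst => hvw.injective hst
  obtain ⟨g, hg, hg', hgu⟩ := exists_orderIso_extension hfin.toFinset u fun s hs t ht hst => by
    rw [Set.Finite.coe_toFinset] at hs ht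
    exact h s t (u s) (u t) hs ht (hu s hs) (hu t ht) hst
  exact ⟨v, w, v', w', hvw, hvw', g, hg, hg', fun t ht => by
    rw [hgu t (hfin.mem_toFinset.2 ht)]; exact hu t ht⟩

theorem distinctDirections_lineForm {ι : Type*} {L : ι → AffineSubspace F (F × F)}
    (hL : ∀ i j, i ≠ j → ¬ (L i).Parallel (L j)) {v w : ι → F × F}
    (hvw : ∀ i, IsLineCoordinate (L i) (v i) (w i)) {k : ι → F} (hk : ∀ i, k i ≠ 0) :
    DistinctDirections fun i => k i • lineForm (v i) (w i) := by
  have key : ∀ i d, (k i • lineForm (v i) (w i)).linear d = k i * crossForm (w i) d :=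
    fun i d => by rw [← lineForm_linear (v i) (w i)]; rfl
  refine ⟨fun i => ?_, fun i j hij d hi hj => ?_⟩
  · by_contra! h
    have hall : ∀ d, crossForm (w i) d = 0 := fun d => by
      have := h d
      rw [key] at this
      exact (mul_eq_zero.1 this).resolve_left (hk i)
    have h1 := hall (1, 0)
    have h2 := hall (0, 1)
    rw [crossForm_apply] at h1 h2
    exact (hvw i).1 (Prod.ext (by simpa using h2) (by simpa using h1))
  · rw [key] at hi hj
    obtain ⟨c, hc⟩ := exists_smul_of_crossForm_eq_zero (hvw i).1
      ((mul_eq_zero.1 hi).resolve_left (hk i))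
    have h1 := (mul_eq_zero.1 hj).resolve_left (hk j)
    have h2 := (hvw j).crossForm_ne_zero (hvw i) (hL j i hij.symm)
    rw [hc, map_smul, smul_eq_mul, mul_eq_zero, or_iff_left h2] at h1
    rw [hc, h1, zero_smul]

/-- If the lines of two arrangements correspond to each other by order isomorphisms that agree at
the intersection points, then the correspondence extends to the plane. -/
theorem exists_isPiecewiseLinearAut_of_orderIso {φ : F × F → F × F} (hA : IsLineArrangement A)
    (hB : IsLineArrangement B) (e : A ≃ B)
    {v w v' w' : A → F × F} (hvw : ∀ L, IsLineCoordinate L.1 (v L) (w L))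
    (hvw' : ∀ L, IsLineCoordinate (e L).1 (v' L) (w' L)) (g : A → F ≃o F)
    (hg : ∀ L, IsHingeSum (g L)) (hg' : ∀ L, IsHingeSum (g L).symm)
    (hφg : ∀ L, ∀ t : F, v L + t • w L ∈ intersectionPoints A →
      φ (v L + t • w L) = v' L + g L t • w' L) :
    ∃ f : (F × F) ≃ (F × F), IsPiecewiseLinearAut f ∧
      ∀ L t, f (v L + t • w L) = v' L + g L t • w' L := by
  rcases isEmpty_or_nonempty A with hempty | hnonempty
  · exact ⟨Equiv.refl _, .refl, fun L => isEmptyElim L⟩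
  have hparA : ∀ L M : A, L ≠ M → ¬ L.1.Parallel M.1 := fun L M h =>
    hA.not_parallel _ L.2 _ M.2 fun h' => h (Subtype.ext h')
  have hparB : ∀ L M : A, L ≠ M → ¬ (e L).1.Parallel (e M).1 := fun L M h =>
    hB.not_parallel _ (e L).2 _ (e M).2 fun h' => h (e.injective (Subtype.ext h'))
  have hpoint : ∀ L M : A, L ≠ M → ∃ s t : F, v L + s • w L = v M + t • w M ∧
      v L + s • w L ∈ intersectionPoints A := fun L M h => by
    have h' : L.1 ≠ M.1 := fun h' => h (Subtype.ext h')
    obtain ⟨p, hpL, hpM⟩ := hA.exists_mem_inter L.2 M.2 h'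
    obtain ⟨s, rfl⟩ := ((hvw L).mem_iff p).1 hpL
    obtain ⟨t, ht⟩ := ((hvw M).mem_iff _).1 hpM
    exact ⟨s, t, ht, L, L.2, M, M.2, h', hpL, hpM⟩
  have hmeet : ∀ L M s t, L ≠ M → v L + s • w L = v M + t • w M →
      v L + s • w L ∈ intersectionPoints A := fun L M s t h hst =>
    ⟨L, L.2, M, M.2, fun h' => h (Subtype.ext h'), (hvw L).add_smul_mem s,
      hst ▸ (hvw M).add_smul_mem t⟩
  obtain ⟨ψ, hψ⟩ := exists_map_on_lines v w (fun L t => v' L + g L t • w' L)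
    fun L M s t hst => by
      by_cases h : L = M
      · subst h
        rw [(hvw L).injective hst]
      · have hp := hmeet L M s t h hst
        rw [← hφg L s hp, ← hφg M t (hst ▸ hp), hst]
  obtain ⟨ψ', hψ'⟩ := exists_map_on_lines v' w' (fun L t => v L + (g L).symm t • w L)
    fun L M s t hst => by
      by_cases h : L = M
      · subst h
        rw [(hvw' L).injective hst]
      -- Two image lines meet only once, so their common point is the image under `φ` of the
      -- crossing of `L` and `M`.
      · obtain ⟨s₀, t₀, hst₀, hp⟩ := hpoint L M h
        have hs := hφg L s₀ hp
        have ht := hφg M t₀ (hst₀ ▸ hp)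
        rw [← hst₀, hs] at ht
        have heq : v' L + s • w' L = v' L + g L s₀ • w' L :=
          hB.eq_of_mem_inter (e L).2 (e M).2 (fun h' => h (e.injective (Subtype.ext h')))
            ((hvw' L).add_smul_mem _) (hst ▸ (hvw' M).add_smul_mem _)
            ((hvw' L).add_smul_mem _) (ht ▸ (hvw' M).add_smul_mem _)
        have h1 := (hvw' L).injective heq
        have h2 := (hvw' M).injective (hst.symm.trans (heq.trans ht))
        simp only [h1, h2, OrderIso.symm_apply_apply, hst₀]
  have hself : ∀ L t, lineForm (v L) (w L) (v L + t • w L) = 0 := fun L t =>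
    (lineForm_eq_zero_iff (hvw L).1 _).2 ⟨t, rfl⟩
  have hself' : ∀ L t, lineForm (v' L) (w' L) (v' L + t • w' L) = 0 := fun L t =>
    (lineForm_eq_zero_iff (hvw' L).1 _).2 ⟨t, rfl⟩
  have hfactor : ∀ M L, L ≠ M → ∃ k : F, k ≠ 0 ∧ ∀ t,
      SignType.sign (k * lineForm (v' M) (w' M) (v' L + g L t • w' L)) =
        SignType.sign (lineForm (v M) (w M) (v L + t • w L)) := fun M L h => by
    obtain ⟨s, t, hst, hp⟩ := hpoint L M h
    refine exists_sign_factor ((hvw M).crossForm_ne_zero (hvw L) (hparA M L h.symm))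
      ((hvw' M).crossForm_ne_zero (hvw' L) (hparB M L h.symm)) (g L) (t₀ := s) ?_ ?_
    · rw [hst]; exact hself M t
    · rw [← hφg L s hp, hst, hφg M t (hst ▸ hp)]; exact hself' M _
  have hsign : ∀ M, ∃ k : F, k ≠ 0 ∧ ∀ L t,
      SignType.sign (k * lineForm (v' M) (w' M) (v' L + g L t • w' L)) =
        SignType.sign (lineForm (v M) (w M) (v L + t • w L)) := fun M => by
    by_cases hM : ∃ L₀, L₀ ≠ M
    · obtain ⟨L₀, hL₀⟩ := hM
      obtain ⟨k, hk, hkL₀⟩ := hfactor M L₀ hL₀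
      refine ⟨k, hk, fun L t => ?_⟩
      by_cases hLM : L = M
      · subst hLM
        simp [hself, hself']
      by_cases hLL₀ : L = L₀
      · rw [hLL₀]; exact hkL₀ t
      obtain ⟨k', -, hkL⟩ := hfactor M L hLM
      -- At the crossing of `L` and `L₀`, which is off `M` since no three lines are concurrent, both
      -- factors must have the same sign.
      obtain ⟨s, s₀, hs, hp⟩ := hpoint L L₀ hLL₀
      have h1 := hkL s
      have h2 := hkL₀ s₀
      have hne : lineForm (v M) (w M) (v L + s • w L) ≠ 0 := fun h0 => by
        refine hA.not_concurrent L L.2 L₀ L₀.2 M M.2 (fun h => hLL₀ (Subtype.ext h))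
          (fun h => hLM (Subtype.ext h)) (fun h => hL₀ (Subtype.ext h))
          ⟨v L + s • w L, (hvw L).add_smul_mem s, hs ▸ (hvw L₀).add_smul_mem s₀, ?_⟩
        exact ((hvw M).mem_iff _).2 ((lineForm_eq_zero_iff (hvw M).1 _).1 h0)
      rw [← hφg L s hp] at h1
      rw [← hφg L₀ s₀ (hs ▸ hp), ← hs, ← h1, sign_mul, sign_mul] at h2
      have hsne : SignType.sign (lineForm (v' M) (w' M) (φ (v L + s • w L))) ≠ 0 := fun h0 => by
        rw [sign_mul, h0, mul_zero] at h1
        exact hne (sign_eq_zero_iff.1 h1.symm)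
      rw [sign_mul, mul_right_cancel₀ hsne h2, ← sign_mul]
      exact hkL t
    · push Not at hM
      exact ⟨1, one_ne_zero, fun L t => by rw [hM L]; simp [hself, hself']⟩
  choose k hk hsign using hsign
  have hD := distinctDirections_lineForm hparA hvw (k := fun _ => 1) fun _ => one_ne_zero
  simp only [one_smul] at hD
  have hD' := distinctDirections_lineForm hparB hvw' hk
  have hzero : ∀ L x, lineForm (v L) (w L) x = 0 → ∃ t : F, x = v L + t • w L :=
    fun L x => (lineForm_eq_zero_iff (hvw L).1 x).1
  have hzero' : ∀ L x, (k L • lineForm (v' L) (w' L)) x = 0 → ∃ t : F, x = v' L + t • w' L :=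
    fun L x hx => (lineForm_eq_zero_iff (hvw' L).1 x).1 ((mul_eq_zero.1 hx).resolve_left (hk L))
  have hlin : ∀ L d, (lineForm (v L) (w L)).linear d = 0 → ∃ c : F, d = c • w L := fun L d hd =>
    exists_smul_of_crossForm_eq_zero (hvw L).1 (by rwa [lineForm_linear] at hd)
  have hlin' : ∀ L d, (k L • lineForm (v' L) (w' L)).linear d = 0 → ∃ c : F, d = c • w' L :=
    fun L d hd => by
      refine exists_smul_of_crossForm_eq_zero (hvw' L).1 ?_
      rw [← lineForm_linear (v' L)]
      exact (mul_eq_zero.1 hd).resolve_left (hk L)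
  have hskel : IsSkeletonMap (fun L => lineForm (v L) (w L))
      (fun L => k L • lineForm (v' L) (w' L)) ψ :=
    isSkeletonMap_of_orderIso (fun L => (hvw L).1) (fun L => (hvw' L).1) g hg hψ hzero hlin
      (fun L => by
        show k L * (lineForm (v' L) (w' L)).linear (w' L) = 0
        rw [lineForm_linear, crossForm_self, mul_zero])
      (fun L M t => hsign M L t)
  have hskel' : IsSkeletonMap (fun L => k L • lineForm (v' L) (w' L))
      (fun L => lineForm (v L) (w L)) ψ' :=
    isSkeletonMap_of_orderIso (fun L => (hvw' L).1) (fun L => (hvw L).1) (fun L => (g L).symm)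
      hg' hψ' hzero' hlin' (fun L => by rw [lineForm_linear, crossForm_self])
      (fun L M t => by
        have := hsign M L ((g L).symm t)
        rw [OrderIso.apply_symm_apply] at this
        exact this.symm)
  obtain ⟨f, hf, hfψ⟩ := exists_isPiecewiseLinearAut_of_skeleton hD hD' hskel hskel'
    (fun L y hy => by
      obtain ⟨t, rfl⟩ := hzero L y hy
      rw [hψ, hψ', OrderIso.symm_apply_apply])
    (fun L y hy => by
      obtain ⟨t, rfl⟩ := hzero' L y hy
      rw [hψ', hψ, OrderIso.apply_symm_apply])
  exact ⟨f, hf, fun L t => by rw [hfψ L _ (hself L t), hψ]⟩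

end Main

theorem theorem4p1 {F : Type*} [Field F] [LinearOrder F] [IsStrictOrderedRing F] (n : ℕ)
    (A B : Finset (AffineSubspace F (F × F))) (hAn : A.card = n) (hBn : B.card = n)
    (hA : IsLineArrangement A) (hB : IsLineArrangement B)
    (φ : F × F → F × F) (hφ : IsLineArrangementCollineationIso A B φ)
    (hord : PreservesIntersectionOrder A B φ) :
    ∃ f : (F × F) ≃ (F × F), IsPiecewiseLinearAut f ∧ TakesArrangementTo f A B := by
  obtain ⟨e, he⟩ := hφ.exists_line_equiv hA hB (hAn.trans hBn.symm)
  choose v w v' w' hvw hvw' g hg hg' hφg using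
    fun L : A => hord.exists_orderIso hA L.2 (e L).2 (he L)
  obtain ⟨f, hf, hfg⟩ :=
    exists_isPiecewiseLinearAut_of_orderIso hA hB e hvw hvw' g hg hg' hφg
  have himage : ∀ L : A, f '' (L.1 : Set (F × F)) = ((e L).1 : Set (F × F)) := fun L => by
    ext y
    rw [(hvw L).2, (hvw' L).2]
    constructor
    · rintro ⟨_, ⟨t, rfl⟩, rfl⟩
      exact ⟨g L t, (hfg L t).symm⟩
    · rintro ⟨t, rfl⟩
      exact ⟨_, ⟨(g L).symm t, rfl⟩, by rw [hfg, OrderIso.apply_symm_apply]⟩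
  refine ⟨f, hf, Set.ext fun S => ⟨?_, ?_⟩⟩
  · rintro ⟨L, hL, rfl⟩
    exact ⟨e ⟨L, hL⟩, (e ⟨L, hL⟩).2, himage ⟨L, hL⟩⟩
  · rintro ⟨M, hM, rfl⟩
    refine ⟨e.symm ⟨M, hM⟩, (e.symm ⟨M, hM⟩).2, ?_⟩
    rw [himage, Equiv.apply_symm_apply]
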